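/- Let $F=\mathbb{F}_q$ be a finite field of odd characteristic and let $\psi:F\to\mathbb{C}^\times$ be a non-trivial additive character. Let $\mathsf{Symp}$ be the category of finite dimensional symplectic vector spaces $V=(V,\omega)$ over $F$ with linear isomorphisms preserving the forms as morphisms; it is monoidal under the Cartesian product, with form $\omega_1+\omega_2$ on $V_1\times V_2$. Let $\mathsf{Vect}$ be the category of finite dimensional complex vector spaces with its tensor product. For $V\in\mathsf{Symp}$ of dimension $2n$ let $H(V)=V\times F$ be the Heisenberg group, $(v,z)(v',z')=(v+v',z+z'+\tfrac12\omega(v,v'))$. An oriented Lagrangian $L^\circ=(L,o_L)$ is a Lagrangian subspace $L\subset V$ with a non-zero vector $o_L\in\bigwedge^{top}L$; $OLag(V)$ is the set of these. Let $\mathcal{H}_{L^\circ}$ be the space of functions $f:H(V)\to\mathbb{C}$ with $f((0,z)\cdot h)=\psi(z)f(h)$ and $f((l,0)\cdot h)=f(h)$ for $z\in F$, $l\in L$, on which $H(V)$ acts by right translation. Let $\sigma$ be the quadratic character of $F^\times$, $G_1=\sum_{z\in F}\psi(\tfrac12z^2)$, and let $\omega_\wedge:\bigwedge^{top}L\times\bigwedge^{top}M\to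 F$ be the pairing induced by $\omega$, with the sign convention $\omega_\wedge(l_1\wedge\dots\wedge l_n,m_1\wedge\dots\wedge m_n)=(-1)^{\binom n2}\det(\omega(l_i,m_j))$. A canonical trivialization is a system of $H(V)$-equivariant linear isomorphisms $T_{M^\circ,L^\circ}:\mathcal{H}_{L^\circ}\to\mathcal{H}_{M^\circ}$, for all $(M^\circ,L^\circ)\in OLag(V)^2$, such that $T_{N^\circ,M^\circ}\circ T_{M^\circ,L^\circ}=T_{N^\circ,L^\circ}$ always, and such that, whenever $L+M=V$, $$T_{M^\circ,L^\circ}[f](h)=(G_1/q)^n\,\sigma\!\left((-1)^{\binom n2}\omega_\wedge(o_L,o_M)\right)\sum_{m\in M}f((m,0)\cdot h).$$ Every $V\in\mathsf{Symp}$ has exactly one canonical trivialization. Let $\mathcal{H}(V)$ be the space of families $(v_{L^\circ}\in\mathcal{H}_{L^\circ})_{L^\circ\in OLag(V)}$ with $T_{M^\circ,L^\circ}(v_{L^\circ})=v_{M^\circ}$ for all $(M^\circ,L^\circ)$. For a morphism $f:V\to U$ let $\mathcal{H}(f):\mathcal{H}(U)\to\mathcal{H}(V)$ be given by $(\mathcal{H}(f)v)_{L^\circ}(x,z)=v_{f(L^\circ)}(f(x),z)$.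 This makes $\mathcal{H}$ a contravariant functor $\mathsf{Symp}\to\mathsf{Vect}$. Let $\rho_V(g)=\mathcal{H}(g^{-1})$, $g\in Sp(V)$, be the canonical model of the Weil representation of $Sp(V)$ on $\mathcal{H}(V)$. **Proposition.** The functor $\mathcal{H}$ admits the structure of a (strong) monoidal functor: there are isomorphisms $$\alpha_{V_1\times V_2}:\mathcal{H}(V_1\times V_2)\xrightarrow{\ \simeq\ }\mathcal{H}(V_1)\otimes\mathcal{H}(V_2),\qquad V_1,V_2\in\mathsf{Symp},$$ natural in $V_1$ and $V_2$, and an isomorphism $\mathcal{H}(0)\simeq\mathbb{C}$, which satisfy the associativity and unit conditions. Moreover these $\alpha_{V_1\times V_2}$ are isomorphisms of representations $$(\rho_{V_1\times V_2})_{|Sp(V_1)\times Sp(V_2)}\xrightarrow{\ \simeq\ }\rho_{V_1}\otimes\rho_{V_2},$$ that is, $\alpha_{V_1\times V_2}\circ\rho_{V_1\times V_2}(g_1\times g_2)=(\rho_{V_1}(g_1)\otimes\rho_{V_2}(g_2))\circ\alpha_{V_1\times V_2}$ for all $g_i\in Sp(V_i)$. -/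

import Mathlib

open CategoryTheory

noncomputable section

namespace CanonicalQuantization

/-! ### Symplectic vector spaces and the Heisenberg group -/

/-- A finite dimensional symplectic vector space over `F` (the zero space is allowed). -/
structure Symp (F : Type) [Field F] where
  carrier : Type
  [addCommGroup : AddCommGroup carrier]
  [module : Module F carrier]
  [finite : FiniteDimensional F carrier]
  form : LinearMap.BilinForm F carrier
  form_alt : form.IsAlt
  form_nondeg : form.Nondegenerate

attribute [instance] Symp.addCommGroup Symp.module Symp.finite

variable {F : Type} [Field F]

namespace Symp

/-- Morphisms of symplectic spaces: linear isomorphisms which preserve the forms. -/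
@[ext]
structure Hom (V W : Symp F) where
  toEquiv : V.carrier ≃ₗ[F] W.carrier
  map_form : ∀ v w, W.form (toEquiv v) (toEquiv w) = V.form v w

/-- The identity morphism. -/
def Hom.id (V : Symp F) : Hom V V := ⟨LinearEquiv.refl F _, fun _ _ => rfl⟩

/-- Composition: first `f`, then `g`. -/
def Hom.comp {U V W : Symp F} (f : Hom U V) (g : Hom V W) : Hom U W :=
  ⟨f.toEquiv.trans g.toEquiv, fun v w => by simp [f.map_form, g.map_form]⟩

/-- The inverse morphism. -/
def Hom.symm {V W : Symp F} (f : Hom V W) : Hom W V :=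
  ⟨f.toEquiv.symm, fun v w => by simp [← f.map_form]⟩

instance : Category (Symp F) where
  Hom := Hom
  id := Hom.id
  comp := Hom.comp

/-- Half the dimension of `V`, that is, `n` for a `2n`-dimensional symplectic space. -/
def halfDim (V : Symp F) : ℕ := Module.finrank F V.carrier / 2

/-- The product of symplectic spaces, `ω((v₁, v₂), (w₁, w₂)) = ω₁(v₁, w₁) + ω₂(v₂, w₂)`. -/
def prod (V W : Symp F) : Symp F where
  carrier := V.carrier × W.carrier
  form := V.form.compl₁₂ (LinearMap.fst F _ _) (LinearMap.fst F _ _) +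
    W.form.compl₁₂ (LinearMap.snd F _ _) (LinearMap.snd F _ _)
  form_alt := fun v => by simp [V.form_alt v.1, W.form_alt v.2]
  form_nondeg := by
    constructor
    · rintro ⟨v, w⟩ h
      have h1 := V.form_nondeg.1 v fun x => by simpa using h (x, 0)
      have h2 := W.form_nondeg.1 w fun x => by simpa using h (0, x)
      simp [h1, h2]
    · rintro ⟨v, w⟩ h
      have h1 := V.form_nondeg.2 v fun x => by simpa using h (x, 0)
      have h2 := W.form_nondeg.2 w fun x => by simpa using h (0, x)
      simp [h1, h2]

@[simp] theorem prod_form (V W : Symp F) (v w : V.carrier × W.carrier) :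
    (V.prod W).form v w = V.form v.1 w.1 + W.form v.2 w.2 := rfl

/-- The zero symplectic space. -/
def zero (F : Type) [Field F] : Symp F where
  carrier := PUnit
  form := 0
  form_alt := fun _ => rfl
  form_nondeg := ⟨fun _ _ => rfl, fun _ _ => rfl⟩

/-- The product of two morphisms. -/
def Hom.prodMap {V V' W W' : Symp F} (f : Hom V V') (g : Hom W W') :
    Hom (V.prod W) (V'.prod W') :=
  ⟨f.toEquiv.prodCongr g.toEquiv, fun v w =>
    congrArg₂ (· + ·) (f.map_form v.1 w.1) (g.map_form v.2 w.2)⟩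

/-- A morphism, regarded as an isomorphism of the category. -/
def Hom.toIso {V W : Symp F} (f : Hom V W) : V ≅ W where
  hom := f
  inv := f.symm
  hom_inv_id := Hom.ext (LinearEquiv.self_trans_symm _)
  inv_hom_id := Hom.ext (LinearEquiv.symm_trans_self _)

/-- The associativity isomorphism `(U × V) × W ≅ U × (V × W)`. -/
def assocHom (U V W : Symp F) : Hom ((U.prod V).prod W) (U.prod (V.prod W)) :=
  ⟨LinearEquiv.prodAssoc F _ _ _, fun _ _ => (add_assoc _ _ _).symm⟩

/-- The isomorphism `0 × V ≅ V`. -/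
def zeroProdHom (V : Symp F) : Hom ((zero F).prod V) V :=
  ⟨{ toFun := fun x => x.2
     invFun := fun v => (PUnit.unit, v)
     map_add' := fun _ _ => rfl
     map_smul' := fun _ _ => rfl
     left_inv := fun _ => rfl
     right_inv := fun _ => rfl }, fun _ _ => (zero_add _).symm⟩

/-- The isomorphism `V × 0 ≅ V`. -/
def prodZeroHom (V : Symp F) : Hom (V.prod (zero F)) V :=
  ⟨{ toFun := fun x => x.1
     invFun := fun v => (v, PUnit.unit)
     map_add' := fun _ _ => rfl
     map_smul' := fun _ _ => rfl
     left_inv := fun _ => rfl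
     right_inv := fun _ => rfl }, fun _ _ => (add_zero _).symm⟩

instance : MonoidalCategoryStruct (Symp F) where
  tensorObj := prod
  whiskerLeft V _ _ f := Hom.prodMap (Hom.id V) f
  whiskerRight f V := Hom.prodMap f (Hom.id V)
  tensorHom := Hom.prodMap
  tensorUnit := zero F
  associator U V W := (assocHom U V W).toIso
  leftUnitor V := (zeroProdHom V).toIso
  rightUnitor V := (prodZeroHom V).toIso

/-- The monoidal structure on `Symp F` given by the Cartesian product. -/
instance : MonoidalCategory (Symp F) where
  tensorHom_def _ _ := rfl
  id_tensorHom_id _ _ := rfl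
  tensorHom_comp_tensorHom _ _ _ _ := rfl
  whiskerLeft_id _ _ := rfl
  id_whiskerRight _ _ := rfl
  associator_naturality _ _ _ := rfl
  leftUnitor_naturality _ := rfl
  rightUnitor_naturality _ := rfl
  pentagon _ _ _ _ := rfl
  triangle _ _ := rfl

/-- The symplectic group `Sp(V)`. -/
def Sp (V : Symp F) : Subgroup (V.carrier ≃ₗ[F] V.carrier) where
  carrier := {g | ∀ v w, V.form (g v) (g w) = V.form v w}
  mul_mem' := fun {a b} ha hb v w => by
    rw [LinearEquiv.mul_apply, LinearEquiv.mul_apply, ha, hb]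
  one_mem' := fun _ _ => rfl
  inv_mem' := fun {a} ha v w => by
    have := ha (a⁻¹ v) (a⁻¹ w)
    rw [← LinearEquiv.mul_apply, ← LinearEquiv.mul_apply, mul_inv_cancel] at this
    exact this.symm

/-- An element of `Sp(V)` as an endomorphism of `V` in the category of symplectic spaces. -/
def Sp.toHom {V : Symp F} (g : Sp V) : V ⟶ V := (⟨g.1, g.2⟩ : Hom V V)

/-- The embedding `Sp(V) × Sp(W) → Sp(V × W)`, `(g₁ × g₂)(v, w) = (g₁ v, g₂ w)`. -/
def spProd (V W : Symp F) : Sp V × Sp W →* Sp (V.prod W) where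
  toFun g := ⟨LinearEquiv.prodCongr g.1.1 g.2.1,
    (Hom.prodMap (⟨g.1.1, g.1.2⟩ : Hom V V) (⟨g.2.1, g.2.2⟩ : Hom W W)).map_form⟩
  map_one' := rfl
  map_mul' _ _ := rfl

/-- The Heisenberg group `H(V) = V × F`. -/
@[ext]
structure Heis (V : Symp F) where
  vec : V.carrier
  z : F

namespace Heis

variable {V : Symp F}

/-- `(v, z) * (v', z') = (v + v', z + z' + ½ ω(v, v'))`. -/
instance : Mul (Heis V) :=
  ⟨fun a b => ⟨a.vec + b.vec, a.z + b.z + 2⁻¹ * V.form a.vec b.vec⟩⟩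
instance : One (Heis V) := ⟨⟨0, 0⟩⟩
instance : Inv (Heis V) := ⟨fun a => ⟨-a.vec, -a.z⟩⟩

@[simp] theorem mul_vec (a b : Heis V) : (a * b).vec = a.vec + b.vec := rfl
@[simp] theorem mul_z (a b : Heis V) :
    (a * b).z = a.z + b.z + 2⁻¹ * V.form a.vec b.vec := rfl
@[simp] theorem one_vec : (1 : Heis V).vec = 0 := rfl
@[simp] theorem one_z : (1 : Heis V).z = 0 := rfl
@[simp] theorem inv_vec (a : Heis V) : (a⁻¹).vec = -a.vec := rfl
@[simp] theorem inv_z (a : Heis V) : (a⁻¹).z = -a.z := rfl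

instance : Group (Heis V) where
  mul_assoc a b c := by
    ext
    · simp [add_assoc]
    · simp; ring
  one_mul a := by ext <;> simp
  mul_one a := by ext <;> simp
  inv_mul_cancel a := by
    ext
    · simp
    · simp [V.form_alt a.vec]

/-- The central element `(0, z)`. -/
def ofCenter (V : Symp F) (z : F) : Heis V := ⟨0, z⟩

/-- The element `(v, 0)`; on an isotropic subspace this is a group homomorphism. -/
def ofVec (v : V.carrier) : Heis V := ⟨v, 0⟩

/-- The map of Heisenberg groups induced by a morphism, `(v, z) ↦ (f v, z)`. -/
def map {V W : Symp F} (f : Hom V W) (h : Heis V) : Heis W := ⟨f.toEquiv h.vec, h.z⟩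

theorem map_mul {V W : Symp F} (f : Hom V W) (a b : Heis V) :
    map f (a * b) = map f a * map f b := by
  ext <;> simp [map, f.map_form]

@[simp] theorem map_symm_map {V W : Symp F} (f : Hom V W) (a : Heis V) :
    map f.symm (map f a) = a := by
  ext <;> simp [map, Hom.symm]

@[simp] theorem map_map_symm {V W : Symp F} (f : Hom V W) (a : Heis W) :
    map f (map f.symm a) = a := by
  ext <;> simp [map, Hom.symm]

@[simp] theorem map_ofCenter {V W : Symp F} (f : Hom V W) (z : F) :
    map f (ofCenter V z) = ofCenter W z := by
  ext <;> simp [map, ofCenter]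

@[simp] theorem map_ofVec {V W : Symp F} (f : Hom V W) (v : V.carrier) :
    map f (ofVec v) = ofVec (f.toEquiv v) := rfl

end Heis

end Symp

open Symp

/-! ### Oriented Lagrangian subspaces -/

/-- `L` is Lagrangian: it is equal to its orthogonal complement with respect to the form. -/
def IsLagrangian (V : Symp F) (L : Submodule F V.carrier) : Prop :=
  V.form.orthogonal L = L

theorem IsLagrangian.finrank_eq {V : Symp F} {L : Submodule F V.carrier}
    (h : IsLagrangian V L) : Module.finrank F L = V.halfDim := by
  have h1 := LinearMap.BilinForm.finrank_orthogonal V.form_nondeg L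
  have h2 := L.finrank_le
  rw [h] at h1
  unfold Symp.halfDim
  omega

/-- An oriented Lagrangian: a Lagrangian subspace `L` with a non-zero vector of the top exterior
power of `L`, that is, of the homogeneous part of degree `dim L` of the exterior algebra. -/
structure OLag (V : Symp F) where
  space : Submodule F V.carrier
  isLagrangian : IsLagrangian V space
  orient : ExteriorAlgebra F space
  orient_mem : orient ∈ ⋀[F]^(Module.finrank F space) space
  orient_ne_zero : orient ≠ 0

/-- Two oriented Lagrangians are in general position if `L + M = V`. -/
def OLag.Transversal {V : Symp F} (M L : OLag V) : Prop := L.space ⊔ M.space = ⊤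

/-- The orientation, as an element of the exterior power of degree `n`, `dim V = 2 n`. -/
def OLag.top {V : Symp F} (L : OLag V) : ⋀[F]^V.halfDim L.space :=
  ⟨L.orient, L.isLagrangian.finrank_eq ▸ L.orient_mem⟩

/-- The pairing `ω_∧ : ⋀ⁿ L × ⋀ⁿ M → F` induced by the symplectic form, with the sign convention
`ω_∧(l₁ ∧ … ∧ lₙ, m₁ ∧ … ∧ mₙ) = (-1)^(n choose 2) det (ω(lᵢ, mⱼ))`
(neighbouring factors `lₙ, m₁` are contracted first). -/
def wedgePairing (V : Symp F) (n : ℕ) (L M : Submodule F V.carrier) :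
    ⋀[F]^n L →ₗ[F] ⋀[F]^n M →ₗ[F] F :=
  (-1 : F) ^ (n.choose 2) • (exteriorPower.pairingDual F M n ∘ₗ
    exteriorPower.map n (V.form.compl₁₂ L.subtype M.subtype))

theorem wedgePairing_ιMulti (V : Symp F) (n : ℕ) (L M : Submodule F V.carrier)
    (l : Fin n → L) (m : Fin n → M) :
    wedgePairing V n L M (exteriorPower.ιMulti F n l) (exteriorPower.ιMulti F n m) =
      (-1) ^ (n.choose 2) *
        (Matrix.of fun i j => V.form (l i : V.carrier) (m j : V.carrier)).det := by
  rw [← Matrix.det_transpose, wedgePairing, LinearMap.smul_apply, LinearMap.comp_apply,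
    exteriorPower.map_apply_ιMulti, LinearMap.smul_apply,
    exteriorPower.pairingDual_ιMulti_ιMulti]
  rfl

/-! ### The models of the Heisenberg representation -/

variable (ψ : AddChar F ℂ)

/-- The space of functions on `H(V)` with `f(z h) = ψ(z) f(h)` and `f(l h) = f(h)`. -/
def model (V : Symp F) (L : Submodule F V.carrier) : Submodule ℂ (Heis V → ℂ) where
  carrier := {f | (∀ z h, f (Heis.ofCenter V z * h) = ψ z * f h) ∧
    ∀ l ∈ L, ∀ h, f (Heis.ofVec l * h) = f h}
  add_mem' := by
    rintro f g ⟨hf, hf'⟩ ⟨hg, hg'⟩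
    exact ⟨fun z h => by simp [hf, hg, mul_add], fun l hl h => by simp [hf' l hl, hg' l hl]⟩
  zero_mem' := ⟨fun _ _ => by simp, fun _ _ _ => rfl⟩
  smul_mem' := by
    rintro c f ⟨hf, hf'⟩
    exact ⟨fun z h => by simp [hf, mul_left_comm], fun l hl h => by simp [hf' l hl]⟩

/-- The action of the Heisenberg group on the model by right translation. -/
def modelRep (V : Symp F) (L : Submodule F V.carrier) :
    Representation ℂ (Heis V) (model ψ V L) where
  toFun h :=
    { toFun := fun f => ⟨fun h' => f.1 (h' * h),
        fun z h' => by simpa only [mul_assoc] using f.2.1 z (h' * h),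
        fun l hl h' => by simpa only [mul_assoc] using f.2.2 l hl (h' * h)⟩
      map_add' := fun _ _ => rfl
      map_smul' := fun _ _ => rfl }
  map_one' := by
    ext f h
    simp
  map_mul' a b := by
    ext f h
    simp [mul_assoc]

/-- The averaging operator `F_{M,L}[f](h) = ∑_{m ∈ M} f(m h)`. -/
def averaging {V : Symp F} (M : Submodule F V.carrier) (f : Heis V → ℂ) (h : Heis V) : ℂ :=
  ∑ᶠ m : M, f (Heis.ofVec (m : V.carrier) * h)

section Finite

variable [Fintype F] [DecidableEq F]

/-- The one-dimensional Gauss sum `G₁ = ∑_z ψ(z² / 2)`. -/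
def gaussSumOne : ℂ := ∑ z : F, ψ (2⁻¹ * z ^ 2)

/-- The normalization `A_{M,L} = (G₁ / q)ⁿ σ((-1)^(n choose 2) ω_∧(o_L, o_M))`, with `σ` the
quadratic character of `F`. -/
def normalization {V : Symp F} (M L : OLag V) : ℂ :=
  (gaussSumOne ψ / Fintype.card F) ^ V.halfDim *
    (quadraticChar F ((-1) ^ (V.halfDim.choose 2) *
      wedgePairing V V.halfDim L.space M.space L.top M.top) : ℂ)

/-- A system of isomorphisms `T_{M,L} : ℋ_L → ℋ_M` between all pairs of models. -/
abbrev IntertwiningSystem (V : Symp F) : Type :=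
  ∀ M L : OLag V, model ψ V L.space ≃ₗ[ℂ] model ψ V M.space

/-- `T` is the canonical trivialization: a multiplicative system of intertwining isomorphisms
which is given on pairs in general position by `T_{M,L} = A_{M,L} F_{M,L}`. -/
structure IsCanonicalSystem (V : Symp F) (T : IntertwiningSystem ψ V) : Prop where
  intertwines : ∀ (M L : OLag V) (h : Heis V) (f : model ψ V L.space),
    T M L (modelRep ψ V L.space h f) = modelRep ψ V M.space h (T M L f)
  multiplicative : ∀ (N M L : OLag V) (f : model ψ V L.space), T N M (T M L f) = T N L f
  ansatz : ∀ M L : OLag V, M.Transversal L → ∀ (f : model ψ V L.space) (h : Heis V),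
    (T M L f).1 h = normalization ψ M L * averaging M.space f.1 h

/-- The families `(v_L)` of vectors of the models which are horizontal, `T_{M,L} v_L = v_M`, for
the canonical system `T` of intertwining morphisms.
(The canonical system is unique; quantifying over it avoids a choice.) -/
def horizontalSections (V : Symp F) : Submodule ℂ (∀ L : OLag V, model ψ V L.space) where
  carrier := {v | ∀ T : IntertwiningSystem ψ V, IsCanonicalSystem ψ V T →
    ∀ M L : OLag V, T M L (v L) = v M}
  add_mem' := fun {v w} hv hw T hT M L => by
    simp [hv T hT M L, hw T hT M L]
  zero_mem' := fun T hT M L => by simp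
  smul_mem' := fun c v hv T hT M L => by simp [hv T hT M L]

/-- The canonical vector space `ℋ(V)` of horizontal sections. -/
def CanonicalSpace (V : Symp F) : Type := horizontalSections ψ V

instance (V : Symp F) : AddCommGroup (CanonicalSpace ψ V) :=
  inferInstanceAs (AddCommGroup (horizontalSections ψ V))

instance (V : Symp F) : Module ℂ (CanonicalSpace ψ V) :=
  inferInstanceAs (Module ℂ (horizontalSections ψ V))

end Finite

/-! ### Functoriality -/

section Transport

variable {V W : Symp F} (f : Hom V W)

theorem isLagrangian_map {L : Submodule F V.carrier} (h : IsLagrangian V L) :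
    IsLagrangian W (L.map (f.toEquiv : V.carrier →ₗ[F] W.carrier)) := by
  ext w
  obtain ⟨v, rfl⟩ := f.toEquiv.surjective w
  have h' : v ∈ V.form.orthogonal L ↔ v ∈ L := by rw [h]
  rw [LinearMap.BilinForm.mem_orthogonal_iff] at h' ⊢
  constructor
  · intro hw
    refine ⟨v, h'.1 fun n hn => ?_, rfl⟩
    have := hw (f.toEquiv n) ⟨n, hn, rfl⟩
    exact (f.map_form n v).symm.trans this
  · rintro ⟨v', hv', e⟩ _ ⟨n, hn, rfl⟩
    obtain rfl := f.toEquiv.injective e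
    exact (f.map_form n v').trans (h'.2 hv' n hn)

/-- The restriction of `f` to an isomorphism from `L` onto its image. -/
abbrev restrictEquiv (L : Submodule F V.carrier) :
    L ≃ₗ[F] L.map (f.toEquiv : V.carrier →ₗ[F] W.carrier) :=
  f.toEquiv.submoduleMap L

theorem coe_exteriorPower_map {A B : Type} [AddCommGroup A] [Module F A] [AddCommGroup B]
    [Module F B] (g : A →ₗ[F] B) (n : ℕ) (x : ⋀[F]^n A) :
    (exteriorPower.map n g x : ExteriorAlgebra F B) = ExteriorAlgebra.map g x := by
  have : (⋀[F]^n B).subtype ∘ₗ exteriorPower.map n g =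
      (ExteriorAlgebra.map g).toLinearMap ∘ₗ (⋀[F]^n A).subtype := by
    apply exteriorPower.linearMap_ext
    ext m
    simp [ExteriorAlgebra.map_apply_ιMulti]
  exact LinearMap.congr_fun this x

/-- The oriented Lagrangian `f(L)`, oriented by the image of the orientation of `L`. -/
def OLag.map (L : OLag V) : OLag W where
  space := L.space.map (f.toEquiv : V.carrier →ₗ[F] W.carrier)
  isLagrangian := isLagrangian_map f L.isLagrangian
  orient := ExteriorAlgebra.map (restrictEquiv f L.space).toLinearMap L.orient
  orient_mem := by
    rw [← (restrictEquiv f L.space).finrank_eq]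
    have := coe_exteriorPower_map (restrictEquiv f L.space).toLinearMap _ ⟨_, L.orient_mem⟩
    exact this ▸ Subtype.property _
  orient_ne_zero := by
    have := ExteriorAlgebra.map_injective_field (f := (restrictEquiv f L.space).toLinearMap)
      (LinearEquiv.ker _)
    exact (map_ne_zero_iff _ this).2 L.orient_ne_zero

theorem OLag.ext_of_map {L M : OLag V} (h : L.space = M.space)
    (h' : ExteriorAlgebra.map L.space.subtype L.orient =
      ExteriorAlgebra.map M.space.subtype M.orient) : L = M := by
  obtain ⟨L, _, o, _, _⟩ := L
  obtain ⟨M, _, p, _, _⟩ := M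
  dsimp only at h h'
  subst h
  obtain rfl := ExteriorAlgebra.map_injective_field (Submodule.ker_subtype L) h'
  rfl

theorem OLag.map_subtype_orient (L : OLag V) :
    ExteriorAlgebra.map (L.map f).space.subtype (L.map f).orient =
      ExteriorAlgebra.map ((f.toEquiv : V.carrier →ₗ[F] W.carrier) ∘ₗ L.space.subtype)
        L.orient := by
  exact AlgHom.congr_fun (ExteriorAlgebra.map_comp_map (restrictEquiv f L.space).toLinearMap
    (Submodule.subtype _)) L.orient

theorem OLag.map_id (L : OLag V) : L.map (Hom.id V) = L :=
  OLag.ext_of_map (Submodule.map_id _) (OLag.map_subtype_orient _ L)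

theorem OLag.map_map {U : Symp F} (g : Hom W U) (L : OLag V) :
    (L.map f).map g = L.map (f.comp g) := by
  refine OLag.ext_of_map (Submodule.map_comp _ _ _).symm ?_
  rw [OLag.map_subtype_orient, OLag.map_subtype_orient, ← ExteriorAlgebra.map_comp_map,
    AlgHom.comp_apply, OLag.map_subtype_orient, ← AlgHom.comp_apply,
    ExteriorAlgebra.map_comp_map]
  rfl

theorem comp_symm : f.comp f.symm = Hom.id V := Hom.ext (LinearEquiv.self_trans_symm _)

theorem symm_comp : f.symm.comp f = Hom.id W := Hom.ext (LinearEquiv.symm_trans_self _)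

theorem OLag.map_map_symm (L : OLag V) : (L.map f).map f.symm = L := by
  rw [OLag.map_map, comp_symm, OLag.map_id]

theorem OLag.map_symm_map (L : OLag W) : (L.map f.symm).map f = L := by
  rw [OLag.map_map, symm_comp, OLag.map_id]

theorem halfDim_eq (f : Hom V W) : V.halfDim = W.halfDim := by
  unfold Symp.halfDim
  rw [f.toEquiv.finrank_eq]

theorem wedgePairing_map (L M : OLag V) :
    wedgePairing W W.halfDim (L.map f).space (M.map f).space (L.map f).top (M.map f).top =
      wedgePairing V V.halfDim L.space M.space L.top M.top := by
  have key : ∀ (n m : ℕ) (_ : n = m) (x : ⋀[F]^n L.space) (y : ⋀[F]^n M.space)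
      (x' : ⋀[F]^m (L.map f).space) (y' : ⋀[F]^m (M.map f).space),
      x'.1 = ExteriorAlgebra.map (restrictEquiv f L.space).toLinearMap x →
      y'.1 = ExteriorAlgebra.map (restrictEquiv f M.space).toLinearMap y →
      wedgePairing W m (L.map f).space (M.map f).space x' y' =
        wedgePairing V n L.space M.space x y := by
    rintro n m rfl x y x' y' hx hy
    obtain rfl : x' = exteriorPower.map n (restrictEquiv f L.space).toLinearMap x :=
      Subtype.ext (hx.trans (coe_exteriorPower_map _ _ _).symm)
    obtain rfl : y' = exteriorPower.map n (restrictEquiv f M.space).toLinearMap y :=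
      Subtype.ext (hy.trans (coe_exteriorPower_map _ _ _).symm)
    have : (wedgePairing W n (L.map f).space (M.map f).space).compl₁₂
        (exteriorPower.map n (restrictEquiv f L.space).toLinearMap)
        (exteriorPower.map n (restrictEquiv f M.space).toLinearMap) =
        wedgePairing V n L.space M.space := by
      apply exteriorPower.linearMap_ext
      ext l : 1
      apply exteriorPower.linearMap_ext
      ext m
      have h := wedgePairing_ιMulti W n (L.map f).space (M.map f).space
        (restrictEquiv f L.space ∘ l) (restrictEquiv f M.space ∘ m)
      have h' := wedgePairing_ιMulti V n L.space M.space l m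
      refine (congrArg₂ (fun a b => wedgePairing W n (L.map f).space (M.map f).space a b)
        (exteriorPower.map_apply_ιMulti _ _) (exteriorPower.map_apply_ιMulti _ _)).trans
        (h.trans (Eq.trans ?_ h'.symm))
      congr 2
      ext i j
      exact f.map_form _ _
    exact LinearMap.congr_fun₂ this x y
  exact key _ _ (halfDim_eq f) _ _ _ _ rfl rfl

/-- Pull-back of functions along `f`, as an isomorphism `ℋ_{f(L)}(W) ≃ ℋ_L(V)`. -/
def pullModel (L : Submodule F V.carrier) (L' : Submodule F W.carrier)
    (h : L.map (f.toEquiv : V.carrier →ₗ[F] W.carrier) = L') :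
    model ψ W L' ≃ₗ[ℂ] model ψ V L where
  toFun g := ⟨fun x => g.1 (Heis.map f x),
    fun z x => by simpa only [Heis.map_mul, Heis.map_ofCenter] using g.2.1 z _,
    fun l hl x => by
      have : f.toEquiv l ∈ L' := h ▸ ⟨l, hl, rfl⟩
      simpa only [Heis.map_mul, Heis.map_ofVec] using g.2.2 _ this _⟩
  invFun g := ⟨fun x => g.1 (Heis.map f.symm x),
    fun z x => by simpa only [Heis.map_mul, Heis.map_ofCenter] using g.2.1 z _,
    fun l hl x => by
      have : f.symm.toEquiv l ∈ L := by
        subst h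
        obtain ⟨v, hv, rfl⟩ := hl
        simpa [Hom.symm] using hv
      simpa only [Heis.map_mul, Heis.map_ofVec] using g.2.2 _ this _⟩
  map_add' _ _ := rfl
  map_smul' _ _ := rfl
  left_inv g := by ext x; simp
  right_inv g := by ext x; simp

@[simp] theorem pullModel_apply (L : Submodule F V.carrier) (L' : Submodule F W.carrier)
    (h : L.map (f.toEquiv : V.carrier →ₗ[F] W.carrier) = L') (g : model ψ W L') (x : Heis V) :
    (pullModel ψ f L L' h g).1 x = g.1 (Heis.map f x) := rfl

@[simp] theorem pullModel_symm_apply (L : Submodule F V.carrier) (L' : Submodule F W.carrier)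
    (h : L.map (f.toEquiv : V.carrier →ₗ[F] W.carrier) = L') (g : model ψ V L) (x : Heis W) :
    ((pullModel ψ f L L' h).symm g).1 x = g.1 (Heis.map f.symm x) := rfl

theorem averaging_map (M : Submodule F V.carrier) (g : Heis W → ℂ) (x : Heis V) :
    averaging (M.map (f.toEquiv : V.carrier →ₗ[F] W.carrier)) g (Heis.map f x) =
      averaging M (fun y => g (Heis.map f y)) x := by
  refine (finsum_eq_of_bijective (restrictEquiv f M) (restrictEquiv f M).bijective ?_).symm
  intro m
  change g (Heis.map f _) = _
  rw [Heis.map_mul, Heis.map_ofVec]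
  rfl

/-- Transport of a system of intertwining morphisms along `f`. -/
def pushSystem (T : IntertwiningSystem ψ V) : IntertwiningSystem ψ W := fun M L =>
  (pullModel ψ f (L.map f.symm).space L.space
      (congrArg OLag.space (OLag.map_symm_map f L))).trans
    ((T (M.map f.symm) (L.map f.symm)).trans
      (pullModel ψ f (M.map f.symm).space M.space
        (congrArg OLag.space (OLag.map_symm_map f M))).symm)

theorem pullModel_pushSystem (T : IntertwiningSystem ψ V) (M L : OLag V)
    (g : model ψ W (L.map f).space) :
    pullModel ψ f M.space (M.map f).space rfl (pushSystem ψ f T (M.map f) (L.map f) g) =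
      T M L (pullModel ψ f L.space (L.map f).space rfl g) := by
  have key : ∀ (M' L' : OLag V) (_ : M' = M) (_ : L' = L)
      (y' : model ψ V L'.space) (y : model ψ V L.space), y'.1 = y.1 →
      (T M' L' y').1 = (T M L y).1 := by
    rintro _ _ rfl rfl y' y h
    rw [Subtype.ext h]
  ext x
  have h := congrFun (key _ _ (OLag.map_map_symm f M) (OLag.map_map_symm f L)
    (pullModel ψ f _ (L.map f).space (congrArg OLag.space (OLag.map_symm_map f _)) g)
    (pullModel ψ f L.space (L.map f).space rfl g) rfl) x
  exact (congrArg (T ((M.map f).map f.symm) ((L.map f).map f.symm) (pullModel ψ f _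
    (L.map f).space (congrArg OLag.space (OLag.map_symm_map f _)) g)).1
    (Heis.map_symm_map f x)).trans h

variable [Fintype F] [DecidableEq F]

theorem normalization_map (M L : OLag V) :
    normalization ψ (M.map f) (L.map f) = normalization ψ M L := by
  unfold normalization
  rw [wedgePairing_map, ← halfDim_eq f]

theorem IsCanonicalSystem.push {T : IntertwiningSystem ψ V} (hT : IsCanonicalSystem ψ V T) :
    IsCanonicalSystem ψ W (pushSystem ψ f T) where
  intertwines M L h g := by
    obtain ⟨M, rfl⟩ : ∃ M' : OLag V, M = M'.map f := ⟨_, (OLag.map_symm_map f M).symm⟩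
    obtain ⟨L, rfl⟩ : ∃ L' : OLag V, L = L'.map f := ⟨_, (OLag.map_symm_map f L).symm⟩
    obtain ⟨h, rfl⟩ : ∃ h' : Heis V, h = Heis.map f h' := ⟨_, (Heis.map_map_symm f h).symm⟩
    have comm : ∀ (N : OLag V) (g : model ψ W (N.map f).space),
        pullModel ψ f N.space (N.map f).space rfl (modelRep ψ W _ (Heis.map f h) g) =
          modelRep ψ V _ h (pullModel ψ f N.space (N.map f).space rfl g) := by
      intro N g
      ext x
      change g.1 _ = g.1 _
      rw [Heis.map_mul]
    apply (pullModel ψ f M.space (M.map f).space rfl).injective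
    rw [comm, pullModel_pushSystem, pullModel_pushSystem, comm, hT.intertwines]
  multiplicative N M L g := by
    obtain ⟨N, rfl⟩ : ∃ N' : OLag V, N = N'.map f := ⟨_, (OLag.map_symm_map f N).symm⟩
    obtain ⟨M, rfl⟩ : ∃ M' : OLag V, M = M'.map f := ⟨_, (OLag.map_symm_map f M).symm⟩
    obtain ⟨L, rfl⟩ : ∃ L' : OLag V, L = L'.map f := ⟨_, (OLag.map_symm_map f L).symm⟩
    apply (pullModel ψ f N.space (N.map f).space rfl).injective
    rw [pullModel_pushSystem, pullModel_pushSystem, pullModel_pushSystem, hT.multiplicative]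
  ansatz M L htr g h := by
    obtain ⟨M, rfl⟩ : ∃ M' : OLag V, M = M'.map f := ⟨_, (OLag.map_symm_map f M).symm⟩
    obtain ⟨L, rfl⟩ : ∃ L' : OLag V, L = L'.map f := ⟨_, (OLag.map_symm_map f L).symm⟩
    obtain ⟨h, rfl⟩ : ∃ h' : Heis V, h = Heis.map f h' := ⟨_, (Heis.map_map_symm f h).symm⟩
    have htr' : M.Transversal L := by
      unfold OLag.Transversal at htr ⊢
      apply Submodule.map_injective_of_injective (f := (f.toEquiv : V.carrier →ₗ[F] W.carrier))
        f.toEquiv.injective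
      rw [Submodule.map_sup, Submodule.map_top, LinearEquiv.range]
      exact htr
    rw [← pullModel_apply ψ f M.space (M.map f).space rfl, pullModel_pushSystem,
      hT.ansatz M L htr', normalization_map]
    exact congrArg _ (averaging_map f M.space g.1 h).symm

/-- The map `ℋ(f) : ℋ(W) → ℋ(V)`: the component at `L` of `ℋ(f) v` is the pull-back of the
component of `v` at `f(L)`. -/
def canonicalMap : CanonicalSpace ψ W →ₗ[ℂ] CanonicalSpace ψ V where
  toFun v := ⟨fun L => pullModel ψ f L.space (L.map f).space rfl (v.1 (L.map f)),
    fun T hT M L => by rw [← pullModel_pushSystem, v.2 _ (hT.push ψ f)]⟩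
  map_add' _ _ := rfl
  map_smul' _ _ := rfl

theorem canonicalMap_id : canonicalMap ψ (Hom.id V) = LinearMap.id := by
  have key : ∀ (v : ∀ L : OLag V, model ψ V L.space) (L L' : OLag V), L = L' →
      (v L).1 = (v L').1 := by
    rintro v L _ rfl
    rfl
  ext v
  refine Subtype.ext (funext fun L => Subtype.ext (funext fun x => ?_))
  exact congrFun (key v.1 _ _ (OLag.map_id L)) x

theorem canonicalMap_comp {U : Symp F} (g : Hom W U) :
    canonicalMap ψ (f.comp g) = canonicalMap ψ f ∘ₗ canonicalMap ψ g := by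
  have key : ∀ (v : ∀ L : OLag U, model ψ U L.space) (L L' : OLag U), L = L' →
      (v L).1 = (v L').1 := by
    rintro v L _ rfl
    rfl
  ext v
  refine Subtype.ext (funext fun L => Subtype.ext (funext fun x => ?_))
  exact congrFun (key v.1 _ _ (OLag.map_map f g L).symm) (Heis.map g (Heis.map f x))

end Transport

/-! ### The quantization functor and the Weil representation -/

section Functor

variable [Fintype F] [DecidableEq F]

instance (V : Symp F) : Finite V.carrier := Module.finite_of_finite F

instance (V : Symp F) : Finite (Heis V) :=
  Finite.of_injective (fun h : Heis V => (h.vec, h.z)) fun a b h => by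
    simp only [Prod.mk.injEq] at h
    exact Heis.ext h.1 h.2

instance (V : Symp F) : Finite (OLag V) := by
  have h1 : ∀ L : Submodule F V.carrier, Finite (⋀[F]^(Module.finrank F L) L) :=
    fun L => Module.finite_of_finite F
  refine Finite.of_injective (fun L : OLag V =>
    (⟨L.space, ⟨L.orient, L.orient_mem⟩⟩ :
      Σ L : Submodule F V.carrier, ⋀[F]^(Module.finrank F L) L)) ?_
  rintro ⟨L, _, o, _, _⟩ ⟨M, _, p, _, _⟩ h
  simp only [Sigma.mk.injEq] at h
  obtain ⟨rfl, h⟩ := h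
  simpa using h

instance (V : Symp F) : Module.Finite ℂ (CanonicalSpace ψ V) :=
  inferInstanceAs (Module.Finite ℂ (horizontalSections ψ V))

/-- The contravariant quantization functor `V ↦ ℋ(V)` to finite dimensional vector spaces. -/
def quantization : (Symp F)ᵒᵖ ⥤ FGModuleCat ℂ where
  obj V := FGModuleCat.of ℂ (CanonicalSpace ψ V.unop)
  map f := FGModuleCat.ofHom (canonicalMap ψ f.unop)
  map_id V := by
    ext1
    exact canonicalMap_id ψ
  map_comp f g := by
    ext1
    exact canonicalMap_comp ψ g.unop f.unop

/-- The canonical model of the Weil representation, `ρ_V(g) = ℋ(g⁻¹)`. -/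
def weilRep (V : Symp F) : Representation ℂ (Sp V) (CanonicalSpace ψ V) where
  toFun g := canonicalMap ψ (Sp.toHom g⁻¹)
  map_one' := canonicalMap_id ψ
  map_mul' a b := by
    rw [mul_inv_rev]
    exact canonicalMap_comp ψ (Sp.toHom a⁻¹) (Sp.toHom b⁻¹)

open MonoidalCategory Opposite in
/-- For a monoidal structure on the functor `ℋ`, its structure isomorphism
`α : ℋ(V × W) ≃ ℋ(V) ⊗ ℋ(W)`, as an isomorphism of vector spaces. -/
def productIso [(quantization (F := F) ψ).Monoidal] (V W : Symp F) :
    CanonicalSpace ψ (V ⊗ W) ≃ₗ[ℂ] TensorProduct ℂ (CanonicalSpace ψ V) (CanonicalSpace ψ W) :=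
  let i : FGModuleCat.of ℂ (CanonicalSpace ψ (V ⊗ W)) ≅
      FGModuleCat.of ℂ (CanonicalSpace ψ V) ⊗ FGModuleCat.of ℂ (CanonicalSpace ψ W) :=
    (Functor.Monoidal.μIso (quantization ψ) (op V) (op W)).symm
  FGModuleCat.isoToLinearEquiv i

end Functor

end CanonicalQuantization

end

open CategoryTheory

noncomputable section

namespace CanonicalQuantization

open Symp

variable {F : Type} [Field F]

/-! ### Lagrangian subspaces -/

/-! Write A_{M,L} for the normalized averaging operator `averagingOp` between the models of two
transversal oriented Lagrangians. Two laws come from direct computation. First, A_{L,M} A_{M,L} = 1: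
averaging over M and then over L is a Fourier inversion, which contributes q^n. Second, A_{N,M}
A_{M,L} = A_{N,L} for pairwise transversal L, M, N: the two averagings compose to one, up to the
Gauss sum of the quadratic form attached to the triple. Diagonalizing that form expresses the Gauss
sum through G_1^n and the quadratic character of a determinant. In both laws G_1^2 = σ(-1) q makes
the normalizing constants cancel.

Any two Lagrangians have a common transversal P, so C_{N,L} = A_{N,P} A_{P,L} can be formed. The
difficulty is independence of P and multiplicativity of C. Filling in triangles directly would need
a Lagrangian transversal to four given ones, which can fail: over a field with three elements a
symplectic plane has only four lines. The way out is doubling. In V × V⁻, where V⁻ carries -ω, the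
diagonal is transversal to L × M exactly when L ∩ M = 0, so it is a common transversal at no cost.
Since A is compatible with the exterior product f ⊠ g of functions (`averagingOp_boxProd`), an
identity proved in V × V⁻ on f ⊠ g yields the identity for f after cancelling a non-zero second
factor (`eq_of_boxProd_eq`). This gives `averagingOp_averagingOp_eq` and `canonicalOp_canonicalOp`,
hence existence of the canonical trivialization; uniqueness holds because every T_{N,L} factors
through transversal pairs.

For the monoidal structure, a horizontal section is determined by its value at one Lagrangian, and ⊠
identifies ℋ_L ⊗ ℋ_M with ℋ_{L × M}, the product carrying the orientation o_L ∧ o_M. As C respects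
⊠, this gives an isomorphism ℋ(V) ⊗ ℋ(W) ≃ ℋ(V × W) described by the same formula at every L × M
(`tensorEquiv_tmul_apply`). Naturality, associativity and unitality are then checked pointwise at a
single product Lagrangian. The statement about Weil representations is naturality applied to g₁⁻¹
and g₂⁻¹. -/

theorem Symp.form_refl (V : Symp F) : V.form.IsRefl := V.form_alt.isRefl

theorem Symp.form_swap (V : Symp F) (x y : V.carrier) : V.form x y = -V.form y x :=
  (V.form_alt.neg_eq y x).symm

theorem IsLagrangian.mem_iff {V : Symp F} {L : Submodule F V.carrier} (h : IsLagrangian V L)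
    (x : V.carrier) : x ∈ L ↔ ∀ y ∈ L, V.form y x = 0 := by
  conv_lhs => rw [← h]
  exact LinearMap.BilinForm.mem_orthogonal_iff

theorem IsLagrangian.form_eq_zero {V : Symp F} {L : Submodule F V.carrier}
    (h : IsLagrangian V L) {x y : V.carrier} (hx : x ∈ L) (hy : y ∈ L) : V.form x y = 0 :=
  (h.mem_iff y).1 hy x hx

theorem Symp.halfDim_add_halfDim_of_isLagrangian {V : Symp F} {L : Submodule F V.carrier}
    (h : IsLagrangian V L) : V.halfDim + V.halfDim = Module.finrank F V.carrier := by
  have h1 := LinearMap.BilinForm.finrank_orthogonal V.form_nondeg L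
  have h2 := L.finrank_le
  rw [h, h.finrank_eq] at h1
  rw [h.finrank_eq] at h2
  omega

theorem IsLagrangian.sup_eq_top_iff {V : Symp F} {L M : Submodule F V.carrier}
    (hL : IsLagrangian V L) (hM : IsLagrangian V M) : L ⊔ M = ⊤ ↔ L ⊓ M = ⊥ := by
  have h := Submodule.finrank_sup_add_finrank_inf_eq L M
  rw [hL.finrank_eq, hM.finrank_eq, halfDim_add_halfDim_of_isLagrangian hL] at h
  constructor
  · intro h'
    rw [h', finrank_top] at h
    exact Submodule.finrank_eq_zero.1 (by omega)
  · intro h'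
    rw [h', finrank_bot] at h
    exact Submodule.eq_top_of_finrank_eq (by omega)

/-- A group is never the union of two proper subgroups, so no lower bound on the size of the field
is needed. -/
theorem exists_mem_notMem_notMem {E : Type} [AddCommGroup E] [Module F E]
    {P A B : Submodule F E} (hA : ¬P ≤ A) (hB : ¬P ≤ B) : ∃ v ∈ P, v ∉ A ∧ v ∉ B := by
  obtain ⟨a, haP, ha⟩ := SetLike.not_le_iff_exists.1 hA
  obtain ⟨b, hbP, hb⟩ := SetLike.not_le_iff_exists.1 hB
  by_cases haB : a ∈ B
  · by_cases hbA : b ∈ A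
    · exact ⟨a + b, P.add_mem haP hbP, fun h => ha ((Submodule.add_mem_iff_left _ hbA).1 h),
        fun h => hb ((Submodule.add_mem_iff_right _ haB).1 h)⟩
    · exact ⟨b, hbP, hbA, hb⟩
  · exact ⟨a, haP, ha, haB⟩

/-- An isotropic subspace `P` with `P ∩ L = 0`, `L` Lagrangian, is Lagrangian as soon as `P + L`
contains the orthogonal complement of `P`. -/
theorem isLagrangian_of_orthogonal_le_sup {V : Symp F} {P L : Submodule F V.carrier}
    (hP : P ≤ V.form.orthogonal P) (hL : IsLagrangian V L) (hPL : P ⊓ L = ⊥)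
    (h : V.form.orthogonal P ≤ P ⊔ L) : IsLagrangian V P := by
  have hdim := LinearMap.BilinForm.finrank_orthogonal V.form_nondeg P
  -- An element of P^⊥ ∩ L is orthogonal to P and to L, hence to P^⊥ ≤ P + L, so it lies in P^⊥⊥ =
  -- P.
  have h1 : V.form.orthogonal P ⊓ L ≤ P := by
    intro x hx
    rw [← LinearMap.BilinForm.orthogonal_orthogonal V.form_nondeg V.form_refl P]
    rw [LinearMap.BilinForm.mem_orthogonal_iff]
    intro y hy
    obtain ⟨p, hp, l, hl, rfl⟩ := Submodule.mem_sup.1 (h hy)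
    have e1 : V.form p x = 0 := (LinearMap.BilinForm.mem_orthogonal_iff.1 hx.1) p hp
    change V.form (p + l) x = 0
    rw [map_add, LinearMap.add_apply, e1, hL.form_eq_zero hl hx.2, add_zero]
  have h2 : V.form.orthogonal P ⊓ L = ⊥ :=
    le_bot_iff.1 (hPL ▸ le_inf h1 inf_le_right)
  have h3 := Submodule.finrank_sup_add_finrank_inf_eq (V.form.orthogonal P) L
  rw [h2, finrank_bot, hL.finrank_eq] at h3
  have h4 := (V.form.orthogonal P ⊔ L).finrank_le
  have h5 := halfDim_add_halfDim_of_isLagrangian hL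
  -- P^⊥ meets L trivially, so dim P^⊥ ≤ n and therefore dim P ≥ n.
  have h6 := Submodule.finrank_mono hP
  have h7 := P.finrank_le
  exact (Submodule.eq_of_le_of_finrank_le hP (by omega)).symm

theorem sup_span_singleton_inf_eq_bot {E : Type} [AddCommGroup E] [Module F E]
    {P L : Submodule F E} (h : P ⊓ L = ⊥) {v : E} (hv : v ∉ P ⊔ L) :
    (P ⊔ F ∙ v) ⊓ L = ⊥ := by
  refine (Submodule.eq_bot_iff _).2 ?_
  rintro x ⟨hx, hxL⟩
  obtain ⟨p, hp, w, hw, rfl⟩ := Submodule.mem_sup.1 hx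
  obtain ⟨c, rfl⟩ := Submodule.mem_span_singleton.1 hw
  by_cases hc : c = 0
  · subst hc
    rw [zero_smul, add_zero] at hxL ⊢
    exact (Submodule.eq_bot_iff _).1 h p ⟨hp, hxL⟩
  · refine absurd ?_ hv
    have : v = c⁻¹ • (-p + (p + c • v)) := by
      rw [neg_add_cancel_left, smul_smul, inv_mul_cancel₀ hc, one_smul]
    rw [this]
    exact Submodule.smul_mem _ _ (Submodule.add_mem_sup (P.neg_mem hp) hxL)

theorem isotropic_sup_span_singleton {V : Symp F} {P : Submodule F V.carrier}
    (hP : P ≤ V.form.orthogonal P) {v : V.carrier} (hv : v ∈ V.form.orthogonal P) :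
    P ⊔ F ∙ v ≤ V.form.orthogonal (P ⊔ F ∙ v) := by
  intro x hx
  rw [LinearMap.BilinForm.mem_orthogonal_iff] at hv ⊢
  intro y hy
  obtain ⟨p, hp, w, hw, rfl⟩ := Submodule.mem_sup.1 hx
  obtain ⟨c, rfl⟩ := Submodule.mem_span_singleton.1 hw
  obtain ⟨p', hp', w', hw', rfl⟩ := Submodule.mem_sup.1 hy
  obtain ⟨c', rfl⟩ := Submodule.mem_span_singleton.1 hw'
  have e1 : V.form p' p = 0 := LinearMap.BilinForm.mem_orthogonal_iff.1 (hP hp) p' hp'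
  have e2 : V.form p' v = 0 := hv p' hp'
  have e3 : V.form v p = 0 := by rw [V.form_swap, show V.form p v = 0 from hv p hp, neg_zero]
  have e4 : V.form v v = 0 := V.form_alt v
  change V.form (p' + c' • v) (p + c • v) = 0
  simp [e1, e2, e3, e4]

/-- A maximal isotropic P meeting L and N trivially is Lagrangian: otherwise P^⊥ lies in neither P +
L nor P + N, and a vector of P^⊥ outside both would enlarge P. -/
theorem exists_isLagrangian_inf_eq_bot {V : Symp F} {L N : Submodule F V.carrier}
    (hL : IsLagrangian V L) (hN : IsLagrangian V N) :
    ∃ P, IsLagrangian V P ∧ P ⊓ L = ⊥ ∧ P ⊓ N = ⊥ := by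
  obtain ⟨P, ⟨hP, hPL, hPN⟩, hmax⟩ := wellFounded_gt.has_min
    {P : Submodule F V.carrier | P ≤ V.form.orthogonal P ∧ P ⊓ L = ⊥ ∧ P ⊓ N = ⊥}
    ⟨⊥, bot_le, bot_inf_eq _, bot_inf_eq _⟩
  refine ⟨P, ?_, hPL, hPN⟩
  by_contra hcon
  obtain ⟨v, hv, hvL, hvN⟩ := exists_mem_notMem_notMem
    (fun h => hcon (isLagrangian_of_orthogonal_le_sup hP hL hPL h))
    (fun h => hcon (isLagrangian_of_orthogonal_le_sup hP hN hPN h))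
  refine hmax (P ⊔ F ∙ v) ⟨?_, sup_span_singleton_inf_eq_bot hPL hvL,
    sup_span_singleton_inf_eq_bot hPN hvN⟩ ?_
  · exact isotropic_sup_span_singleton hP hv
  · refine lt_of_le_of_ne le_sup_left fun h => hvL (Submodule.mem_sup_left ?_)
    rw [h]
    exact Submodule.mem_sup_right (Submodule.mem_span_singleton_self v)

theorem exists_isLagrangian (V : Symp F) : ∃ P, IsLagrangian V P := by
  obtain ⟨P, hP, hmax⟩ := wellFounded_gt.has_min
    {P : Submodule F V.carrier | P ≤ V.form.orthogonal P} ⟨⊥, (bot_le : ⊥ ≤ V.form.orthogonal ⊥)⟩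
  refine ⟨P, le_antisymm (fun v hv => ?_) hP⟩
  by_contra hvP
  refine hmax (P ⊔ F ∙ v) ?_ ?_
  · exact isotropic_sup_span_singleton hP hv
  · refine lt_of_le_of_ne le_sup_left fun h => hvP ?_
    rw [h]
    exact Submodule.mem_sup_right (Submodule.mem_span_singleton_self v)

/-! ### Orientations and bases -/

/-- The determinant relative to b factors through the top exterior power and takes the value 1 on b.
-/
theorem exteriorAlgebra_ιMulti_basis_ne_zero {E : Type} [AddCommGroup E] [Module F E] {n : ℕ}
    (b : Module.Basis (Fin n) F E) : ExteriorAlgebra.ιMulti F n b ≠ 0 := by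
  intro h
  have h' : exteriorPower.ιMulti F n b = 0 := Subtype.ext h
  have := exteriorPower.alternatingMapLinearEquiv_apply_ιMulti b.det b
  rw [h', map_zero, b.det_self] at this
  exact zero_ne_one this

theorem exists_eq_smul_ιMulti_basis {E : Type} [AddCommGroup E] [Module F E] {n : ℕ}
    (b : Module.Basis (Fin n) F E) {x : ExteriorAlgebra F E} (hx : x ∈ ⋀[F]^n E) :
    ∃ c : F, x = c • ExteriorAlgebra.ιMulti F n b := by
  have key : LinearMap.id = (exteriorPower.alternatingMapLinearEquiv b.det).smulRight
      (exteriorPower.ιMulti F n b) := by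
    apply exteriorPower.linearMap_ext
    -- Alternating maps need only be compared on injective tuples of basis vectors, and on n indices
    -- these are the permutations of b.
    apply Module.Basis.ext_alternating b
    intro v hv
    obtain ⟨σ, rfl⟩ : ∃ σ : Equiv.Perm (Fin n), v = σ :=
      ⟨Equiv.ofBijective v (Finite.injective_iff_bijective.1 hv), rfl⟩
    simp only [LinearMap.compAlternatingMap_apply, LinearMap.id_apply, LinearMap.smulRight_apply,
      exteriorPower.alternatingMapLinearEquiv_apply_ιMulti]
    have h1 := (exteriorPower.ιMulti F n (M := E)).map_perm b σ
    have h2 := b.det.map_perm b σ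
    rw [b.det_self] at h2
    change exteriorPower.ιMulti F n (b ∘ σ) = b.det (b ∘ σ) • exteriorPower.ιMulti F n b
    rw [h1, h2]
    rcases Int.units_eq_one_or (Equiv.Perm.sign σ) with h | h
    · rw [h, one_smul, one_smul, one_smul]
    · rw [h, Units.neg_smul, one_smul, Units.neg_smul, one_smul]
      exact (neg_one_smul F _).symm
  exact ⟨_, congrArg Subtype.val (LinearMap.congr_fun key ⟨x, hx⟩)⟩

theorem OLag.exists_orient_eq {V : Symp F} (L : OLag V) {n : ℕ}
    (b : Module.Basis (Fin n) F L.space) :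
    ∃ c : F, c ≠ 0 ∧ L.orient = c • ExteriorAlgebra.ιMulti F n b := by
  have hn : Module.finrank F L.space = n := by simpa using Module.finrank_eq_card_basis b
  have hm := L.orient_mem
  rw [hn] at hm
  obtain ⟨c, hc⟩ := exists_eq_smul_ιMulti_basis b hm
  refine ⟨c, ?_, hc⟩
  rintro rfl
  exact L.orient_ne_zero (by rw [hc, zero_smul])

theorem IsLagrangian.exists_oLag {V : Symp F} {L : Submodule F V.carrier}
    (h : IsLagrangian V L) : ∃ M : OLag V, M.space = L :=
  ⟨⟨L, h, ExteriorAlgebra.ιMulti F _ (Module.finBasis F L),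
    (exteriorPower.ιMulti F _ (Module.finBasis F L)).2,
    exteriorAlgebra_ιMulti_basis_ne_zero _⟩, rfl⟩

theorem OLag.transversal_iff {V : Symp F} (M L : OLag V) :
    M.Transversal L ↔ M.space ⊓ L.space = ⊥ := by
  rw [OLag.Transversal, sup_comm]
  exact M.isLagrangian.sup_eq_top_iff L.isLagrangian

theorem OLag.Transversal.symm {V : Symp F} {M L : OLag V} (h : M.Transversal L) :
    L.Transversal M := by
  rw [OLag.transversal_iff] at *
  rwa [inf_comm]

theorem OLag.exists_transversal {V : Symp F} (L N : OLag V) :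
    ∃ P : OLag V, P.Transversal L ∧ P.Transversal N := by
  obtain ⟨P, hP, h1, h2⟩ := exists_isLagrangian_inf_eq_bot L.isLagrangian N.isLagrangian
  obtain ⟨P, rfl⟩ := hP.exists_oLag
  exact ⟨P, (transversal_iff _ _).2 h1, (transversal_iff _ _).2 h2⟩

instance (V : Symp F) : Nonempty (OLag V) :=
  let ⟨_, h⟩ := exists_isLagrangian V
  ⟨h.exists_oLag.choose⟩

/-- The pairing of two orientations which are given by frames of the Lagrangians. -/
theorem wedgePairing_of_frames {V : Symp F} (L M : OLag V) {n : ℕ} (hn : V.halfDim = n)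
    {l : Fin n → L.space} {m : Fin n → M.space} {c d : F}
    (hl : L.orient = c • ExteriorAlgebra.ιMulti F n l)
    (hm : M.orient = d • ExteriorAlgebra.ιMulti F n m) :
    (-1 : F) ^ (V.halfDim.choose 2) * wedgePairing V V.halfDim L.space M.space L.top M.top =
      c * d * (Matrix.of fun i j => V.form (l i : V.carrier) (m j : V.carrier)).det := by
  subst hn
  have h1 : L.top = c • exteriorPower.ιMulti F _ l := Subtype.ext hl
  have h2 : M.top = d • exteriorPower.ιMulti F _ m := Subtype.ext hm
  rw [h1, h2, LinearMap.map_smul₂, map_smul, wedgePairing_ιMulti, smul_eq_mul,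
    smul_eq_mul]
  -- The explicit sign and the one built into ω_∧ cancel, so only the Gram determinant remains in
  -- the normalization.
  have h3 : (-1 : F) ^ (V.halfDim.choose 2) * (-1) ^ (V.halfDim.choose 2) = 1 := by
    rw [← mul_pow, neg_one_mul, neg_neg, one_pow]
  linear_combination c * d *
    (Matrix.of fun i j => V.form (l i : V.carrier) (m j : V.carrier)).det * h3

/-! ### Quadratic Gauss sums -/

theorem two_ne_zero_of_ringChar (hF : ringChar F ≠ 2) : (2 : F) ≠ 0 :=
  Ring.two_ne_zero hF

theorem mulShift_ne_one {ψ : AddChar F ℂ} (hψ : ψ ≠ 1) {a : F} (ha : a ≠ 0) :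
    ψ.mulShift a ≠ 1 := AddChar.IsPrimitive.of_ne_one hψ ha

theorem addChar_map_sum {A ι : Type} [AddCommMonoid A] (χ : AddChar A ℂ) (s : Finset ι)
    (f : ι → A) : χ (∑ i ∈ s, f i) = ∏ i ∈ s, χ (f i) :=
  map_prod χ.toMonoidHom (fun i => Multiplicative.ofAdd (f i)) s

section GaussSums

variable [Fintype F] [DecidableEq F]

theorem quadraticChar_mul_self {a : F} (ha : a ≠ 0) :
    (quadraticChar F a : ℂ) * quadraticChar F a = 1 := by
  have := quadraticChar_sq_one ha
  rw [sq] at this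
  exact_mod_cast this

/-- The quadratic character with complex values. -/
def complexQuadraticChar (F : Type) [Field F] [Fintype F] [DecidableEq F] : MulChar F ℂ :=
  (quadraticChar F).ringHomComp (Int.castRingHom ℂ)

theorem complexQuadraticChar_apply (a : F) :
    complexQuadraticChar F a = (quadraticChar F a : ℂ) := rfl

theorem complexQuadraticChar_ne_one (hF : ringChar F ≠ 2) : complexQuadraticChar F ≠ 1 :=
  (MulChar.ringHomComp_ne_one_iff (RingHom.injective_int _)).2 (quadraticChar_ne_one hF)

theorem complexQuadraticChar_isQuadratic : (complexQuadraticChar F).IsQuadratic :=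
  (quadraticChar_isQuadratic F).comp _

/-- An element a has 1 + σ(a) square roots, and the constant 1 contributes nothing because χ is
non-trivial. -/
theorem sum_addChar_sq {χ : AddChar F ℂ} (hF : ringChar F ≠ 2) (hχ : χ ≠ 1) :
    ∑ x : F, χ (x ^ 2) = gaussSum (complexQuadraticChar F) χ := by
  have h1 : ∑ x : F, χ (x ^ 2) =
      ∑ a : F, ((quadraticChar F a + 1 : ℤ) : ℂ) * χ a := by
    rw [← Finset.sum_fiberwise' Finset.univ (fun x : F => x ^ 2) (fun a => χ a)]
    refine Finset.sum_congr rfl fun a _ => ?_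
    rw [Finset.sum_const, ← quadraticChar_card_sqrts hF a, nsmul_eq_mul, Int.cast_natCast]
    congr 3
    ext x
    simp
  rw [h1, gaussSum]
  simp only [Int.cast_add, Int.cast_one, add_mul, one_mul, Finset.sum_add_distrib,
    AddChar.sum_eq_zero_of_ne_one hχ, add_zero]
  rfl

/-- For every b ≠ 0 the sum of ψ(b x²) is σ(b) times one fixed Gauss sum; compare b = a/2 with b =
1/2. -/
theorem sum_half_mul_sq {ψ : AddChar F ℂ} (hF : ringChar F ≠ 2) (hψ : ψ ≠ 1) {a : F}
    (ha : a ≠ 0) : ∑ x : F, ψ (2⁻¹ * (a * x ^ 2)) = quadraticChar F a * gaussSumOne ψ := by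
  have h2 : (2⁻¹ : F) ≠ 0 := inv_ne_zero (two_ne_zero_of_ringChar hF)
  have key : ∀ b : F, b ≠ 0 → ∑ x : F, ψ (b * x ^ 2) =
      quadraticChar F b * gaussSum (complexQuadraticChar F) ψ := by
    intro b hb
    have h3 := sum_addChar_sq hF (mulShift_ne_one hψ hb)
    simp only [AddChar.mulShift_apply] at h3
    rw [h3]
    have h4 := gaussSum_mulShift (complexQuadraticChar F) ψ (Units.mk0 b hb)
    rw [Units.val_mk0] at h4
    rw [← h4, ← mul_assoc, complexQuadraticChar_apply, quadraticChar_mul_self hb, one_mul]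
  have h5 := key _ h2
  have h6 := key _ (mul_ne_zero h2 ha)
  unfold gaussSumOne
  rw [h5, ← mul_assoc, ← Int.cast_mul, ← map_mul, mul_comm a, ← h6]
  simp only [mul_assoc]

theorem gaussSumOne_sq {ψ : AddChar F ℂ} (hF : ringChar F ≠ 2) (hψ : ψ ≠ 1) :
    gaussSumOne ψ ^ 2 = quadraticChar F (-1) * Fintype.card F := by
  have h2 : (2⁻¹ : F) ≠ 0 := inv_ne_zero (two_ne_zero_of_ringChar hF)
  have h3 := sum_addChar_sq hF (mulShift_ne_one hψ h2)
  simp only [AddChar.mulShift_apply] at h3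
  unfold gaussSumOne
  rw [h3, gaussSum_sq (complexQuadraticChar_ne_one hF) complexQuadraticChar_isQuadratic
    (AddChar.IsPrimitive.of_ne_one (mulShift_ne_one hψ h2))]
  rfl

/-- The Gauss sum of a diagonalized quadratic form. -/
theorem sum_half_bilin_of_orthogonal {ψ : AddChar F ℂ} (hF : ringChar F ≠ 2) (hψ : ψ ≠ 1)
    {E : Type} [AddCommGroup E] [Module F E] [Fintype E] {n : ℕ}
    (b : Module.Basis (Fin n) F E) (B : LinearMap.BilinForm F E) (hB : B.IsOrthoᵢ b)
    (h0 : ∀ i, B (b i) (b i) ≠ 0) :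
    ∑ x : E, ψ (2⁻¹ * B x x) =
      quadraticChar F (∏ i, B (b i) (b i)) * gaussSumOne ψ ^ n := by
  have h1 : ∀ x : Fin n → F, ψ (2⁻¹ * B (b.equivFun.symm x) (b.equivFun.symm x)) =
      ∏ i, ψ (2⁻¹ * (B (b i) (b i) * x i ^ 2)) := by
    intro x
    have e : B (b.equivFun.symm x) (b.equivFun.symm x) = ∑ i, B (b i) (b i) * x i ^ 2 := by
      rw [Module.Basis.equivFun_symm_apply, map_sum]
      refine Finset.sum_congr rfl fun i _ => ?_
      rw [map_sum, LinearMap.sum_apply, Finset.sum_eq_single i]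
      · simp only [map_smul, LinearMap.smul_apply, smul_eq_mul]
        ring
      · intro j _ hj
        have : B (b j) (b i) = 0 := hB hj
        simp [this]
      · simp
    rw [e, Finset.mul_sum, addChar_map_sum]
  rw [← Equiv.sum_comp b.equivFun.symm.toEquiv]
  calc _ = ∑ x : Fin n → F, ∏ i, ψ (2⁻¹ * (B (b i) (b i) * x i ^ 2)) :=
        Finset.sum_congr rfl fun x _ => h1 x
    _ = ∏ i, ∑ x : F, ψ (2⁻¹ * (B (b i) (b i) * x ^ 2)) := by
        rw [Finset.prod_univ_sum, Fintype.piFinset_univ]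
    _ = _ := by
        simp only [sum_half_mul_sq hF hψ (h0 _), Finset.prod_mul_distrib, Finset.prod_const,
          Finset.card_univ, Fintype.card_fin, map_prod, Int.cast_prod]

end GaussSums

/-! ### Averaging operators between the models -/

/-- The commutator of v and w in the Heisenberg group is the central element (0, ω(v, w)). -/
theorem model_apply_ofVec_mul_comm {ψ : AddChar F ℂ} (h2 : (2 : F) ≠ 0) {V : Symp F}
    {L : Submodule F V.carrier} (f : model ψ V L) (v w : V.carrier) (h : Heis V) :
    f.1 (Heis.ofVec v * (Heis.ofVec w * h)) =
      ψ (V.form v w) * f.1 (Heis.ofVec w * (Heis.ofVec v * h)) := by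
  rw [← f.2.1]
  refine congrArg f.1 (Heis.ext ?_ ?_)
  · simp [Heis.ofVec, Heis.ofCenter, add_left_comm]
  · simp only [Heis.ofVec, Heis.ofCenter, Heis.mul_z, Heis.mul_vec, map_add, map_zero,
      LinearMap.zero_apply]
    rw [V.form_swap w v]
    field_simp
    ring

/-- Splitting off the factor v - w, which f absorbs, costs the central correction -½ ω(v, w). -/
theorem model_apply_ofVec_mul_of_sub_mem {ψ : AddChar F ℂ} {V : Symp F}
    {L : Submodule F V.carrier} (f : model ψ V L) {v w : V.carrier} (hvw : v - w ∈ L)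
    (h : Heis V) : f.1 (Heis.ofVec v * h) =
      ψ (-(2⁻¹ * V.form v w)) * f.1 (Heis.ofVec w * h) := by
  have h1 : Heis.ofVec v * h =
      Heis.ofCenter V (-(2⁻¹ * V.form v w)) * (Heis.ofVec (v - w) * (Heis.ofVec w * h)) := by
    ext
    · simp [Heis.ofVec, Heis.ofCenter, ← add_assoc]
    · simp only [Heis.ofVec, Heis.ofCenter, Heis.mul_z, Heis.mul_vec, map_add, map_zero, map_sub,
        LinearMap.sub_apply, LinearMap.zero_apply]
      rw [show V.form w w = 0 from V.form_alt w]
      ring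
  rw [h1, f.2.1, f.2.2 _ hvw]

theorem ofVec_mul_ofVec {V : Symp F} {v w : V.carrier} (h : V.form v w = 0) :
    (Heis.ofVec v : Heis V) * Heis.ofVec w = Heis.ofVec (v + w) := by
  ext
  · simp [Heis.ofVec]
  · simp [Heis.ofVec, h]

theorem averaging_eq_sum {V : Symp F} (M : Submodule F V.carrier) [Fintype M]
    (f : Heis V → ℂ) (h : Heis V) :
    averaging M f h = ∑ m : M, f (Heis.ofVec (m : V.carrier) * h) :=
  finsum_eq_sum_of_fintype _

section Finite

variable [Fintype F]

theorem averaging_mem (ψ : AddChar F ℂ) {V : Symp F} {M L : Submodule F V.carrier}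
    (hM : IsLagrangian V M) (f : model ψ V L) : averaging M f.1 ∈ model ψ V M := by
  have := Fintype.ofFinite M
  constructor
  · intro z h
    simp only [averaging_eq_sum, Finset.mul_sum]
    refine Finset.sum_congr rfl fun m _ => ?_
    rw [← f.2.1]
    refine congrArg f.1 (Heis.ext ?_ ?_)
    · simp [Heis.ofVec, Heis.ofCenter]
    · simp [Heis.ofVec, Heis.ofCenter, add_assoc]
  · intro l hl h
    simp only [averaging_eq_sum]
    refine (Finset.sum_congr rfl fun m _ => ?_).trans (Equiv.sum_comp (Equiv.addRight
      (⟨l, hl⟩ : M)) fun m : M => f.1 (Heis.ofVec (m : V.carrier) * h))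
    rw [← mul_assoc, ofVec_mul_ofVec (hM.form_eq_zero m.2 hl)]
    rfl

/-- Moving l past m produces ψ(ω(m, l)). As a character of l ∈ L it is trivial only for m ∈ L^⊥ = L,
that is m = 0, and this term contributes |L| = q^n. -/
theorem averaging_averaging_self {ψ : AddChar F ℂ} (hF : ringChar F ≠ 2) (hψ : ψ ≠ 1)
    {V : Symp F} {L M : Submodule F V.carrier}
    (hL : IsLagrangian V L) (hLM : M ⊓ L = ⊥) (f : model ψ V L) :
    averaging L (averaging M f.1) = ((Fintype.card F : ℂ) ^ V.halfDim) • f.1 := by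
  have := Fintype.ofFinite M
  have := Fintype.ofFinite L
  classical
  ext h
  simp only [averaging_eq_sum, Pi.smul_apply, smul_eq_mul]
  rw [Finset.sum_comm]
  let χ : M → AddChar L ℂ := fun m =>
    ψ.compAddMonoidHom ((V.form m ∘ₗ L.subtype : L →ₗ[F] F) : L →+ F)
  have hχ : ∀ m : M, m ≠ 0 → χ m ≠ 0 := by
    intro m hm h0
    have hmL : (m : V.carrier) ∉ L := by
      intro hmem
      exact hm (Subtype.ext ((Submodule.eq_bot_iff _).1 hLM m ⟨m.2, hmem⟩))
    rw [hL.mem_iff] at hmL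
    push Not at hmL
    obtain ⟨y, hy, hne⟩ := hmL
    have hne' : V.form m y ≠ 0 := by rwa [V.form_swap, neg_ne_zero]
    apply hψ
    ext a
    -- This multiple of y pairs with m to give a, so triviality of χ m would force ψ(a) = 1.
    have := DFunLike.congr_fun h0 (⟨(a / V.form m y) • y, L.smul_mem _ hy⟩ : L)
    simpa [χ, hne'] using this
  have key : ∀ m : M, ∑ l : L, f.1 (Heis.ofVec (m : V.carrier) *
      (Heis.ofVec (l : V.carrier) * h)) =
      (∑ l : L, χ m l) * f.1 (Heis.ofVec (m : V.carrier) * h) := by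
    intro m
    rw [Finset.sum_mul]
    refine Finset.sum_congr rfl fun l _ => ?_
    rw [model_apply_ofVec_mul_comm (two_ne_zero_of_ringChar hF), f.2.2 _ l.2]
    rfl
  simp only [key]
  rw [Finset.sum_eq_single 0]
  · have h0 : χ 0 = 0 := by ext l; simp [χ]
    rw [AddChar.sum_eq_ite, if_pos h0, Module.card_eq_pow_finrank (K := F), hL.finrank_eq,
      Nat.cast_pow]
    congr 2
    exact congrArg f.1 (one_mul h)
  · intro m _ hm
    rw [AddChar.sum_eq_ite, if_neg (hχ m hm), zero_mul]
  · simp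

variable [DecidableEq F]

variable (ψ : AddChar F ℂ)

/-- The operator `A_{M,L} F_{M,L}`, the normalized averaging operator from `ℋ_L` to `ℋ_M`. -/
def averagingOp {V : Symp F} (M L : OLag V) : model ψ V L.space →ₗ[ℂ] model ψ V M.space where
  toFun f := normalization ψ M L • ⟨averaging M.space f.1, averaging_mem ψ M.isLagrangian f⟩
  map_add' f g := by
    have := Fintype.ofFinite M.space
    ext h
    simp [averaging_eq_sum, Finset.sum_add_distrib, mul_add]
  map_smul' c f := by
    have := Fintype.ofFinite M.space
    ext h
    simp [averaging_eq_sum, ← Finset.mul_sum, mul_left_comm]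

theorem averagingOp_apply {V : Symp F} (M L : OLag V) (f : model ψ V L.space) (h : Heis V) :
    (averagingOp ψ M L f).1 h = normalization ψ M L * averaging M.space f.1 h := rfl

theorem averagingOp_modelRep {V : Symp F} (M L : OLag V) (h : Heis V)
    (f : model ψ V L.space) :
    averagingOp ψ M L (modelRep ψ V L.space h f) = modelRep ψ V M.space h (averagingOp ψ M L f) := by
  ext x
  change _ = (averagingOp ψ M L f).1 (x * h)
  rw [averagingOp_apply, averagingOp_apply]
  refine congrArg _ (finsum_congr fun m => ?_)
  change f.1 _ = _
  rw [mul_assoc]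

theorem normalization_of_frames {V : Symp F} (M L : OLag V) {n : ℕ} (hn : V.halfDim = n)
    {l : Fin n → L.space} {m : Fin n → M.space} {c d : F}
    (hl : L.orient = c • ExteriorAlgebra.ιMulti F n l)
    (hm : M.orient = d • ExteriorAlgebra.ιMulti F n m) :
    normalization ψ M L = (gaussSumOne ψ / Fintype.card F) ^ n *
      (quadraticChar F (c * d *
        (Matrix.of fun i j => V.form (l i : V.carrier) (m j : V.carrier)).det) : ℂ) := by
  unfold normalization
  rw [wedgePairing_of_frames L M hn hl hm, hn]

variable {ψ}

/-- Follows from G_1² = σ(-1) q. Both composition laws for the normalized operators reduce to this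
scalar identity. -/
theorem gaussSumOne_div_card_sq (hF : ringChar F ≠ 2) (hψ : ψ ≠ 1) (n : ℕ) :
    ((gaussSumOne ψ / Fintype.card F) ^ n) ^ 2 * (quadraticChar F ((-1) ^ n) : ℂ) *
      (Fintype.card F : ℂ) ^ n = 1 := by
  have hq : (Fintype.card F : ℂ) ≠ 0 := Nat.cast_ne_zero.2 Fintype.card_ne_zero
  have h1 : (quadraticChar F (-1) : ℂ) * quadraticChar F (-1) = 1 :=
    quadraticChar_mul_self (neg_ne_zero.2 one_ne_zero)
  rw [map_pow, Int.cast_pow, ← pow_mul, mul_comm n 2, pow_mul, ← mul_pow, ← mul_pow, div_pow,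
    gaussSumOne_sq hF hψ]
  rw [show (quadraticChar F (-1) : ℂ) * Fintype.card F / Fintype.card F ^ 2 *
    quadraticChar F (-1) * Fintype.card F =
      (quadraticChar F (-1) * quadraticChar F (-1)) * (Fintype.card F ^ 2 / Fintype.card F ^ 2)
    by ring, h1, div_self (pow_ne_zero _ hq), one_mul, one_pow]

end Finite

/-! ### Composition laws for the normalized averaging operators -/

section Finite

/-- A vector in the left kernel of the Gram matrix gives an element of L orthogonal to M, hence in
M^⊥ ∩ L = M ∩ L = 0. -/
theorem det_form_ne_zero {V : Symp F} {L M : Submodule F V.carrier} (hM : IsLagrangian V M)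
    (h : M ⊓ L = ⊥) {n : ℕ} (l : Module.Basis (Fin n) F L) (m : Module.Basis (Fin n) F M) :
    (Matrix.of fun i j => V.form (l i : V.carrier) (m j : V.carrier)).det ≠ 0 := by
  intro h0
  obtain ⟨v, hv, hv0⟩ := Matrix.exists_vecMul_eq_zero_iff.2 h0
  set x : L := ∑ i, v i • l i with hx
  have h1 : ∀ j, V.form (x : V.carrier) (m j : V.carrier) = 0 := by
    intro j
    have := congrFun hv0 j
    simp only [Matrix.vecMul, dotProduct, Matrix.of_apply, Pi.zero_apply] at this
    simpa [hx] using this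
  have h2 : V.form (x : V.carrier) ∘ₗ M.subtype = 0 := m.ext h1
  have h3 : (x : V.carrier) ∈ M := by
    rw [hM.mem_iff]
    intro y hy
    rw [V.form_swap, show V.form x y = 0 from LinearMap.congr_fun h2 ⟨y, hy⟩, neg_zero]
  have h4 : x = 0 := Subtype.ext ((Submodule.eq_bot_iff _).1 h x ⟨h3, x.2⟩)
  refine hv (funext fun i => ?_)
  exact Fintype.linearIndependent_iff.1 l.linearIndependent v (hx.symm.trans h4) i

/-- The data of three pairwise transversal Lagrangians: `M → N` and `M → L` with difference the
inclusion of `M`. -/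
theorem exists_graph_equivs {V : Symp F} {L M N : Submodule F V.carrier}
    (hL : IsLagrangian V L) (hM : IsLagrangian V M) (hN : IsLagrangian V N)
    (hML : M ⊓ L = ⊥) (hNM : N ⊓ M = ⊥) (hNL : N ⊓ L = ⊥) :
    ∃ (α : M ≃ₗ[F] N) (β : M ≃ₗ[F] L), ∀ m : M, (m : V.carrier) = β m + α m := by
  -- Since V = L ⊕ N, the two projections restrict to M; they are injective because M meets L and N
  -- trivially.
  have hc : IsCompl L N := by
    refine ⟨disjoint_iff.2 (by rwa [inf_comm]), codisjoint_iff.2 ?_⟩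
    exact (hL.sup_eq_top_iff hN).2 (by rwa [inf_comm])
  let β := (L.projectionOnto N hc) ∘ₗ M.subtype
  let α := (N.projectionOnto L hc.symm) ∘ₗ M.subtype
  have hsum : ∀ m : M, (m : V.carrier) = β m + α m := fun m =>
    (Submodule.projection_add_projection_eq_self hc m).symm
  have hα : Function.Injective α := by
    rw [← LinearMap.ker_eq_bot, LinearMap.ker_eq_bot']
    intro m hm
    have h := hsum m
    rw [hm, Submodule.coe_zero, add_zero] at h
    exact Subtype.ext ((Submodule.eq_bot_iff _).1 hML m ⟨m.2, h ▸ (β m).2⟩)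
  have hβ : Function.Injective β := by
    rw [← LinearMap.ker_eq_bot, LinearMap.ker_eq_bot']
    intro m hm
    have h := hsum m
    rw [hm, Submodule.coe_zero, zero_add] at h
    exact Subtype.ext ((Submodule.eq_bot_iff _).1 hNM m ⟨h ▸ (α m).2, m.2⟩)
  refine ⟨LinearEquiv.ofInjectiveOfFinrankEq α hα (hM.finrank_eq.trans hN.finrank_eq.symm),
    LinearEquiv.ofInjectiveOfFinrankEq β hβ (hM.finrank_eq.trans hL.finrank_eq.symm),
    fun m => ?_⟩
  exact hsum m

/-- Expanding ω(x, y) = 0 along x = βx + αx and y = βy + αy leaves only the mixed terms, because L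
and N are isotropic. It makes m ↦ ω(m, αm) the quadratic form of a symmetric bilinear form. -/
theorem form_graph_symm {V : Symp F} {L M N : Submodule F V.carrier}
    (hL : IsLagrangian V L) (hM : IsLagrangian V M) (hN : IsLagrangian V N)
    (α : M ≃ₗ[F] N) (β : M ≃ₗ[F] L) (h : ∀ m : M, (m : V.carrier) = β m + α m) (x y : M) :
    V.form x (α y) = V.form y (α x) := by
  have h1 : V.form (x : V.carrier) y = 0 := hM.form_eq_zero x.2 y.2
  have h2 : V.form (α x : V.carrier) (α y) = 0 := hN.form_eq_zero (α x).2 (α y).2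
  have h3 : V.form (β x : V.carrier) (β y) = 0 := hL.form_eq_zero (β x).2 (β y).2
  have h4 : V.form (α y : V.carrier) (α x) = 0 := hN.form_eq_zero (α y).2 (α x).2
  have h5 := V.form_swap (α x) (β y)
  rw [h x, h y] at h1 ⊢
  simp only [map_add, LinearMap.add_apply] at h1 ⊢
  linear_combination h1 - h3 - h4 - h5

variable [Fintype F]

/-- Modulo L the element m may be replaced by αm ∈ N, at the cost of ψ(-½ ω(m, αm)); the translation
by αm is then absorbed in the sum over N. -/
theorem averaging_averaging_of_graph {ψ : AddChar F ℂ} {V : Symp F}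
    {L M N : Submodule F V.carrier} (hN : IsLagrangian V N)
    [Fintype M] (α : M ≃ₗ[F] N) (β : M ≃ₗ[F] L) (h : ∀ m : M, (m : V.carrier) = β m + α m)
    (f : model ψ V L) :
    averaging N (averaging M f.1) =
      (∑ m : M, ψ (-(2⁻¹ * V.form (m : V.carrier) (α m)))) • averaging N f.1 := by
  have := Fintype.ofFinite N
  ext x
  simp only [averaging_eq_sum, Pi.smul_apply, smul_eq_mul]
  rw [Finset.sum_comm, Finset.sum_mul]
  refine Finset.sum_congr rfl fun m _ => ?_
  rw [Finset.mul_sum]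
  have h1 : (m : V.carrier) - α m ∈ L := by
    rw [h m, add_sub_cancel_right]
    exact (β m).2
  simp only [model_apply_ofVec_mul_of_sub_mem f h1]
  rw [← Finset.mul_sum, ← Finset.mul_sum]
  congr 1
  refine (Finset.sum_congr rfl fun n _ => ?_).trans (Equiv.sum_comp (Equiv.addLeft (α m))
    fun n : N => f.1 (Heis.ofVec (n : V.carrier) * x))
  rw [← mul_assoc, ofVec_mul_ofVec (hN.form_eq_zero (α m).2 n.2)]
  rfl

variable [DecidableEq F] {ψ : AddChar F ℂ}

/-- Exchanging L and M replaces the Gram matrix by minus its transpose. The resulting σ((-1)^n), the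
squared Gauss factor and the q^n of `averaging_averaging_self` multiply to 1. -/
theorem averagingOp_averagingOp_self (hF : ringChar F ≠ 2) (hψ : ψ ≠ 1) {V : Symp F}
    {M L : OLag V} (h : M.Transversal L) (f : model ψ V L.space) :
    averagingOp ψ L M (averagingOp ψ M L f) = f := by
  rw [OLag.transversal_iff] at h
  let l := Module.finBasisOfFinrankEq F L.space L.isLagrangian.finrank_eq
  let m := Module.finBasisOfFinrankEq F M.space M.isLagrangian.finrank_eq
  obtain ⟨c, hc, hl⟩ := L.exists_orient_eq l
  obtain ⟨d, hd, hm⟩ := M.exists_orient_eq m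
  set A := Matrix.of fun i j => V.form (l i : V.carrier) (m j : V.carrier) with hA
  have hdet : A.det ≠ 0 := det_form_ne_zero M.isLagrangian h l m
  have hdet' : (Matrix.of fun i j => V.form (m i : V.carrier) (l j : V.carrier)).det =
      (-1) ^ V.halfDim * A.det := by
    have : (Matrix.of fun i j => V.form (m i : V.carrier) (l j : V.carrier)) = -A.transpose := by
      ext i j
      exact V.form_swap _ _
    rw [this, Matrix.det_neg, Matrix.det_transpose, Fintype.card_fin]
  have hn : normalization ψ L M * normalization ψ M L * (Fintype.card F : ℂ) ^ V.halfDim = 1 := by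
    rw [normalization_of_frames ψ M L rfl hl hm, normalization_of_frames ψ L M rfl hm hl, hdet']
    have h1 := quadraticChar_mul_self (mul_ne_zero (mul_ne_zero hc hd) hdet)
    have h2 := gaussSumOne_div_card_sq hF hψ V.halfDim
    rw [show d * c * ((-1) ^ V.halfDim * A.det) = (-1) ^ V.halfDim * (c * d * A.det) by ring,
      map_mul (quadraticChar F) ((-1) ^ V.halfDim), Int.cast_mul]
    linear_combination h2 + (((gaussSumOne ψ / Fintype.card F) ^ V.halfDim) ^ 2 *
      (quadraticChar F ((-1) ^ V.halfDim) : ℂ) * (Fintype.card F : ℂ) ^ V.halfDim) * h1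
  have := Fintype.ofFinite L.space
  ext x
  have h3 := congrFun (averaging_averaging_self hF hψ L.isLagrangian h f) x
  have h4 : averaging L.space (averagingOp ψ M L f).1 x =
      normalization ψ M L * averaging L.space (averaging M.space f.1) x := by
    rw [averaging_eq_sum, averaging_eq_sum, Finset.mul_sum]
    rfl
  rw [averagingOp_apply, h4, h3, Pi.smul_apply, smul_eq_mul]
  linear_combination f.1 x * hn

/-- The scalar in `averaging_averaging_of_graph` is a Gauss sum, evaluated in an orthogonal basis of
M. Using the images of that basis as frames of L and N gives the same determinant D in all three
normalizations and, up to (-1)^n, in the Gauss sum. -/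
theorem averagingOp_averagingOp (hF : ringChar F ≠ 2) (hψ : ψ ≠ 1) {V : Symp F}
    {N M L : OLag V} (hNM : N.Transversal M) (hML : M.Transversal L) (hNL : N.Transversal L)
    (f : model ψ V L.space) :
    averagingOp ψ N M (averagingOp ψ M L f) = averagingOp ψ N L f := by
  rw [OLag.transversal_iff] at hNM hML hNL
  obtain ⟨α, β, h⟩ := exists_graph_equivs L.isLagrangian M.isLagrangian N.isLagrangian hML hNM hNL
  -- The sign is chosen so that the weight of m is exactly ψ(½ B(m, m)).
  let B : LinearMap.BilinForm F M.space :=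
    -(V.form.compl₁₂ M.space.subtype (N.space.subtype ∘ₗ α.toLinearMap))
  have hBapp : ∀ x y, B x y = -V.form (x : V.carrier) (α y) := fun _ _ => rfl
  have hBsymm : LinearMap.IsSymm B := ⟨fun x y => by
    rw [RingHom.id_apply, hBapp, hBapp, form_graph_symm L.isLagrangian M.isLagrangian
      N.isLagrangian α β h]⟩
  have := invertibleOfNonzero (two_ne_zero_of_ringChar hF)
  -- The orthogonal basis is indexed by dim M while the normalization involves half of dim V; one
  -- variable n stands for both.
  obtain ⟨n, hn', m, hm⟩ : ∃ n, V.halfDim = n ∧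
      ∃ m : Module.Basis (Fin n) F M.space, B.IsOrthoᵢ m :=
    ⟨_, M.isLagrangian.finrank_eq.symm, LinearMap.BilinForm.exists_orthogonal_basis hBsymm⟩
  obtain ⟨c, hc, hl⟩ := L.exists_orient_eq (m.map β)
  obtain ⟨d, hd, hm'⟩ := M.exists_orient_eq m
  obtain ⟨e, he, hnn⟩ := N.exists_orient_eq (m.map α)
  set D := (Matrix.of fun i j => V.form (m i : V.carrier) (m.map α j : V.carrier)).det with hD
  have hβα : ∀ i j, V.form (m.map β i : V.carrier) (m.map α j : V.carrier) =
      V.form (m i : V.carrier) (m.map α j : V.carrier) := by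
    intro i j
    rw [h (m i), map_add, LinearMap.add_apply,
      N.isLagrangian.form_eq_zero (α (m i)).2 (m.map α j).2, add_zero, m.map_apply]
  have hβm : ∀ i j, V.form (m.map β i : V.carrier) (m j : V.carrier) =
      V.form (m i : V.carrier) (m.map α j : V.carrier) := by
    intro i j
    rw [← hβα, h (m j), map_add, L.isLagrangian.form_eq_zero (m.map β i).2 (β (m j)).2, zero_add,
      m.map_apply α]
  have hD0 : D ≠ 0 := det_form_ne_zero N.isLagrangian hNM m (m.map α)
  have hprod : ∏ i, B (m i) (m i) = (-1) ^ n * D := by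
    have : (Matrix.of fun i j => V.form (m i : V.carrier) (m.map α j : V.carrier)) =
        -Matrix.diagonal fun i => B (m i) (m i) := by
      ext i j
      rw [Matrix.of_apply, Matrix.neg_apply, m.map_apply]
      by_cases hij : i = j
      · subst hij
        rw [Matrix.diagonal_apply_eq, hBapp, neg_neg]
      · have h0 : B (m i) (m j) = 0 := hm hij
        rw [Matrix.diagonal_apply_ne _ hij, neg_zero]
        rwa [hBapp, neg_eq_zero] at h0
    rw [hD, this, Matrix.det_neg, Matrix.det_diagonal, Fintype.card_fin, ← mul_assoc, ← mul_pow,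
      neg_one_mul, neg_neg, one_pow, one_mul]
  have hB0 : ∀ i, B (m i) (m i) ≠ 0 := by
    have : ∏ i, B (m i) (m i) ≠ 0 := by
      rw [hprod]
      exact mul_ne_zero (pow_ne_zero _ (neg_ne_zero.2 one_ne_zero)) hD0
    exact fun i => Finset.prod_ne_zero_iff.1 this i (Finset.mem_univ i)
  have := Fintype.ofFinite M.space
  have := Fintype.ofFinite N.space
  have hgauss : ∑ x : M.space, ψ (-(2⁻¹ * V.form (x : V.carrier) (α x))) =
      quadraticChar F ((-1) ^ n * D) * gaussSumOne ψ ^ n := by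
    rw [← hprod, ← sum_half_bilin_of_orthogonal hF hψ m B hm hB0]
    simp only [hBapp, mul_neg]
  have hnorm : normalization ψ N M * normalization ψ M L *
      (quadraticChar F ((-1) ^ n * D) * gaussSumOne ψ ^ n) = normalization ψ N L := by
    rw [normalization_of_frames ψ N M hn' hm' hnn, normalization_of_frames ψ M L hn' hl hm',
      normalization_of_frames ψ N L hn' hl hnn]
    simp only [hβα, hβm, ← hD]
    have h1 := quadraticChar_mul_self hd
    have h2 := quadraticChar_mul_self hD0
    have h3 := gaussSumOne_div_card_sq hF hψ n
    have hq : (Fintype.card F : ℂ) ^ n ≠ 0 :=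
      pow_ne_zero _ (Nat.cast_ne_zero.2 Fintype.card_ne_zero)
    -- The Gauss sum supplies the third factor (G_1/q)^n together with q^n, so that
    -- `gaussSumOne_div_card_sq` leaves a single factor.
    have h4 : gaussSumOne ψ ^ n = (gaussSumOne ψ / Fintype.card F) ^ n *
        (Fintype.card F : ℂ) ^ n := by
      rw [div_pow, div_mul_cancel₀ _ hq]
    rw [h4]
    simp only [map_mul, Int.cast_mul]
    set K := (gaussSumOne ψ / Fintype.card F) ^ n
    set Q := (Fintype.card F : ℂ) ^ n
    set sd := (quadraticChar F d : ℂ)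
    set sc := (quadraticChar F c : ℂ)
    set se := (quadraticChar F e : ℂ)
    set sD := (quadraticChar F D : ℂ)
    set s1 := (quadraticChar F ((-1) ^ n) : ℂ)
    linear_combination K * sc * se * sD * h3 + K ^ 3 * sc * se * sD ^ 3 * s1 * Q * h1 +
      K ^ 3 * sc * se * sD * s1 * Q * h2
  ext x
  have h3 := congrFun (averaging_averaging_of_graph N.isLagrangian α β h f) x
  have h4 : averaging N.space (averagingOp ψ M L f).1 x =
      normalization ψ M L * averaging N.space (averaging M.space f.1) x := by
    rw [averaging_eq_sum, averaging_eq_sum, Finset.mul_sum]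
    rfl
  rw [averagingOp_apply, averagingOp_apply, h4, h3, Pi.smul_apply, smul_eq_mul, hgauss, ← hnorm]
  ring

end Finite

/-! ### Products of oriented Lagrangians -/

theorem Symp.halfDim_prod (V W : Symp F) : (V.prod W).halfDim = V.halfDim + W.halfDim := by
  obtain ⟨L, hL⟩ := exists_isLagrangian V
  obtain ⟨M, hM⟩ := exists_isLagrangian W
  have h1 := halfDim_add_halfDim_of_isLagrangian hL
  have h2 := halfDim_add_halfDim_of_isLagrangian hM
  have h3 : Module.finrank F (V.prod W).carrier =
      Module.finrank F V.carrier + Module.finrank F W.carrier := Module.finrank_prod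
  change Module.finrank F (V.prod W).carrier / 2 = _
  omega

/-- The vector `(v, w)` of the product of two symplectic spaces. -/
def prodVec {V W : Symp F} (v : V.carrier) (w : W.carrier) : (V.prod W).carrier := (v, w)

/-- The product of two subspaces, as a subspace of the product of the symplectic spaces. -/
def prodSpace {V W : Symp F} (L : Submodule F V.carrier) (M : Submodule F W.carrier) :
    Submodule F (V.prod W).carrier := Submodule.prod L M

theorem IsLagrangian.prod {V W : Symp F} {L : Submodule F V.carrier} {M : Submodule F W.carrier}
    (hL : IsLagrangian V L) (hM : IsLagrangian W M) :
    IsLagrangian (V.prod W) (prodSpace L M) := by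
  refine Submodule.ext fun x => ?_
  rw [LinearMap.BilinForm.mem_orthogonal_iff]
  obtain ⟨x, y⟩ := x
  constructor
  · intro h
    refine ⟨(hL.mem_iff x).2 fun v hv => ?_, (hM.mem_iff y).2 fun w hw => ?_⟩
    · have := h (v, 0) ⟨hv, M.zero_mem⟩
      change V.form v x + W.form 0 y = 0 at this
      simpa using this
    · have := h (0, w) ⟨L.zero_mem, hw⟩
      change V.form 0 x + W.form w y = 0 at this
      simpa using this
  · rintro ⟨hx, hy⟩ ⟨v, w⟩ ⟨hv, hw⟩
    change V.form v x + W.form w y = 0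
    rw [hL.form_eq_zero hv hx, hM.form_eq_zero hw hy, add_zero]

/-- The product of subspaces is isomorphic to the product of the spaces. -/
def prodSpaceEquiv {V W : Symp F} (L : Submodule F V.carrier) (M : Submodule F W.carrier) :
    (L × M) ≃ₗ[F] prodSpace L M where
  toFun x := ⟨(x.1.1, x.2.1), x.1.2, x.2.2⟩
  invFun x := (⟨x.1.1, x.2.1⟩, ⟨x.1.2, x.2.2⟩)
  map_add' _ _ := rfl
  map_smul' _ _ := rfl
  left_inv _ := rfl
  right_inv _ := rfl

/-- The inclusion of the first factor. -/
def prodSpaceInl {V W : Symp F} (L : Submodule F V.carrier) (M : Submodule F W.carrier) :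
    L →ₗ[F] prodSpace L M := (prodSpaceEquiv L M).toLinearMap ∘ₗ LinearMap.inl F L M

/-- The inclusion of the second factor. -/
def prodSpaceInr {V W : Symp F} (L : Submodule F V.carrier) (M : Submodule F W.carrier) :
    M →ₗ[F] prodSpace L M := (prodSpaceEquiv L M).toLinearMap ∘ₗ LinearMap.inr F L M

/-- The product orientation `o_L ∧ o_M`. -/
def prodOrient {V W : Symp F} (L : OLag V) (M : OLag W) :
    ExteriorAlgebra F (prodSpace L.space M.space) :=
  ExteriorAlgebra.map (prodSpaceInl L.space M.space) L.orient *
    ExteriorAlgebra.map (prodSpaceInr L.space M.space) M.orient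

theorem prodOrient_of_frames {V W : Symp F} (L : OLag V) (M : OLag W) {n k : ℕ}
    {l : Fin n → L.space} {m : Fin k → M.space} {c d : F}
    (hl : L.orient = c • ExteriorAlgebra.ιMulti F n l)
    (hm : M.orient = d • ExteriorAlgebra.ιMulti F k m) :
    prodOrient L M = (c * d) • ExteriorAlgebra.ιMulti F (n + k)
      (Fin.append (prodSpaceInl L.space M.space ∘ l) (prodSpaceInr L.space M.space ∘ m)) := by
  rw [prodOrient, hl, hm, map_smul, map_smul, ExteriorAlgebra.map_apply_ιMulti,
    ExteriorAlgebra.map_apply_ιMulti, smul_mul_smul_comm, ExteriorAlgebra.ιMulti_mul_ιMulti]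

/-- A basis of the product of two subspaces. -/
def prodSpaceBasis {V W : Symp F} {L : Submodule F V.carrier} {M : Submodule F W.carrier}
    {n k : ℕ} (l : Module.Basis (Fin n) F L) (m : Module.Basis (Fin k) F M) :
    Module.Basis (Fin (n + k)) F (prodSpace L M) :=
  ((l.prod m).map (prodSpaceEquiv L M)).reindex finSumFinEquiv

theorem coe_prodSpaceBasis {V W : Symp F} {L : Submodule F V.carrier}
    {M : Submodule F W.carrier} {n k : ℕ} (l : Module.Basis (Fin n) F L)
    (m : Module.Basis (Fin k) F M) :
    ⇑(prodSpaceBasis l m) = Fin.append (prodSpaceInl L M ∘ l) (prodSpaceInr L M ∘ m) := by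
  ext1 i
  refine Fin.addCases (fun i => ?_) (fun i => ?_) i
  · simp [prodSpaceBasis, prodSpaceInl]
  · simp [prodSpaceBasis, prodSpaceInr]

/-- The product of two oriented Lagrangians, with the orientation `o_L ∧ o_M`. -/
def OLag.prod {V W : Symp F} (L : OLag V) (M : OLag W) : OLag (V.prod W) where
  space := prodSpace L.space M.space
  isLagrangian := L.isLagrangian.prod M.isLagrangian
  orient := prodOrient L M
  orient_mem := by
    obtain ⟨c, -, hl⟩ := L.exists_orient_eq (Module.finBasis F L.space)
    obtain ⟨d, -, hm⟩ := M.exists_orient_eq (Module.finBasis F M.space)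
    rw [prodOrient_of_frames L M hl hm, (L.isLagrangian.prod M.isLagrangian).finrank_eq,
      halfDim_prod, ← L.isLagrangian.finrank_eq, ← M.isLagrangian.finrank_eq]
    exact Submodule.smul_mem _ _ (exteriorPower.ιMulti F _ _).2
  orient_ne_zero := by
    obtain ⟨c, hc, hl⟩ := L.exists_orient_eq (Module.finBasis F L.space)
    obtain ⟨d, hd, hm⟩ := M.exists_orient_eq (Module.finBasis F M.space)
    rw [prodOrient_of_frames L M hl hm, ← coe_prodSpaceBasis]
    exact smul_ne_zero (mul_ne_zero hc hd) (exteriorAlgebra_ιMulti_basis_ne_zero _)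

theorem OLag.prod_transversal {V W : Symp F} {L L' : OLag V} {M M' : OLag W}
    (h : L.Transversal L') (h' : M.Transversal M') : (L.prod M).Transversal (L'.prod M') := by
  rw [OLag.transversal_iff] at h h' ⊢
  refine (Submodule.eq_bot_iff _).2 ?_
  rintro ⟨x, y⟩ ⟨⟨h1, h2⟩, ⟨h3, h4⟩⟩
  exact Prod.ext ((Submodule.eq_bot_iff _).1 h x ⟨h1, h3⟩)
    ((Submodule.eq_bot_iff _).1 h' y ⟨h2, h4⟩)

/-- V and W are orthogonal in the product, so the Gram matrix of the concatenated frames is block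
diagonal. -/
theorem det_prod_frames {V W : Symp F} {L L' : Submodule F V.carrier}
    {M M' : Submodule F W.carrier} {n k : ℕ} (l : Fin n → L) (l' : Fin n → L')
    (m : Fin k → M) (m' : Fin k → M') :
    (Matrix.of fun i j => (V.prod W).form
      (↑(Fin.append (prodSpaceInl L M ∘ l) (prodSpaceInr L M ∘ m) i) : (V.prod W).carrier)
      (↑(Fin.append (prodSpaceInl L' M' ∘ l') (prodSpaceInr L' M' ∘ m') j) :
        (V.prod W).carrier)).det =
      (Matrix.of fun i j => V.form (l i : V.carrier) (l' j : V.carrier)).det *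
      (Matrix.of fun i j => W.form (m i : W.carrier) (m' j : W.carrier)).det := by
  rw [← Matrix.det_fromBlocks_zero₂₁ _ 0, ← Matrix.det_reindex_self finSumFinEquiv]
  congr 1
  ext i j
  rw [Matrix.of_apply, Matrix.reindex_apply, Matrix.submatrix_apply]
  refine Fin.addCases (fun i => ?_) (fun i => ?_) i <;>
    refine Fin.addCases (fun j => ?_) (fun j => ?_) j
  · rw [Fin.append_left, Fin.append_left, finSumFinEquiv_symm_apply_castAdd,
      finSumFinEquiv_symm_apply_castAdd, Matrix.fromBlocks_apply₁₁]
    change V.form (l i : V.carrier) (l' j : V.carrier) + W.form 0 0 = _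
    rw [map_zero, add_zero]
    rfl
  · rw [Fin.append_left, Fin.append_right, finSumFinEquiv_symm_apply_castAdd,
      finSumFinEquiv_symm_apply_natAdd, Matrix.fromBlocks_apply₁₂]
    change V.form (l i : V.carrier) 0 + W.form 0 (m' j : W.carrier) = _
    simp
  · rw [Fin.append_left, Fin.append_right, finSumFinEquiv_symm_apply_castAdd,
      finSumFinEquiv_symm_apply_natAdd, Matrix.fromBlocks_apply₂₁]
    change V.form 0 (l' j : V.carrier) + W.form (m i : W.carrier) 0 = _
    simp
  · rw [Fin.append_right, Fin.append_right, finSumFinEquiv_symm_apply_natAdd,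
      finSumFinEquiv_symm_apply_natAdd, Matrix.fromBlocks_apply₂₂]
    change V.form 0 0 + W.form (m i : W.carrier) (m' j : W.carrier) = _
    rw [map_zero, zero_add]
    rfl

theorem normalization_prod [Fintype F] [DecidableEq F] (ψ : AddChar F ℂ) {V W : Symp F}
    (M L : OLag V) (M' L' : OLag W) :
    normalization ψ (M.prod M') (L.prod L') = normalization ψ M L * normalization ψ M' L' := by
  obtain ⟨a, -, ha⟩ :=
    M.exists_orient_eq (Module.finBasisOfFinrankEq F M.space M.isLagrangian.finrank_eq)
  obtain ⟨b, -, hb⟩ :=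
    L.exists_orient_eq (Module.finBasisOfFinrankEq F L.space L.isLagrangian.finrank_eq)
  obtain ⟨c, -, hc⟩ :=
    M'.exists_orient_eq (Module.finBasisOfFinrankEq F M'.space M'.isLagrangian.finrank_eq)
  obtain ⟨d, -, hd⟩ :=
    L'.exists_orient_eq (Module.finBasisOfFinrankEq F L'.space L'.isLagrangian.finrank_eq)
  rw [normalization_of_frames ψ (M.prod M') (L.prod L') (halfDim_prod V W)
    (prodOrient_of_frames L L' hb hd) (prodOrient_of_frames M M' ha hc),
    normalization_of_frames ψ M L rfl hb ha, normalization_of_frames ψ M' L' rfl hd hc]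
  have h := det_prod_frames (Module.finBasisOfFinrankEq F L.space L.isLagrangian.finrank_eq)
    (Module.finBasisOfFinrankEq F M.space M.isLagrangian.finrank_eq)
    (Module.finBasisOfFinrankEq F L'.space L'.isLagrangian.finrank_eq)
    (Module.finBasisOfFinrankEq F M'.space M'.isLagrangian.finrank_eq)
  refine (congrArg (fun x : F => (gaussSumOne ψ / Fintype.card F) ^ (V.halfDim + W.halfDim) *
    (quadraticChar F (b * d * (a * c) * x) : ℂ)) h).trans ?_
  simp only [map_mul, Int.cast_mul, pow_add]
  ring

/-! ### Exterior products of functions -/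

section BoxProd

variable {ψ : AddChar F ℂ}

theorem model_apply_eq {V : Symp F} {L : Submodule F V.carrier} (f : model ψ V L) (h : Heis V) :
    f.1 h = ψ h.z * f.1 (Heis.ofVec h.vec) := by
  rw [← f.2.1]
  refine congrArg f.1 (Heis.ext ?_ ?_) <;> simp [Heis.ofCenter, Heis.ofVec]

theorem model_ext {V : Symp F} {L : Submodule F V.carrier} {f g : model ψ V L}
    (h : ∀ v, f.1 (Heis.ofVec v) = g.1 (Heis.ofVec v)) : f = g := by
  ext x
  rw [model_apply_eq, h, ← model_apply_eq]

theorem model_apply_ofVec_mul {V : Symp F} {L : Submodule F V.carrier} (f : model ψ V L)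
    (v w : V.carrier) : f.1 (Heis.ofVec v * Heis.ofVec w) =
      ψ (2⁻¹ * V.form v w) * f.1 (Heis.ofVec (v + w)) := by
  rw [model_apply_eq]
  simp [Heis.ofVec]

/-- The function `(v, w, z) ↦ f(v, z) g(w, 0) = f(v, 0) g(w, z)`. -/
def boxProdFun {V W : Symp F} {L : Submodule F V.carrier} {M : Submodule F W.carrier}
    (f : model ψ V L) (g : model ψ W M) : model ψ (V.prod W) (prodSpace L M) :=
  ⟨fun h => ψ h.z * (f.1 (Heis.ofVec h.vec.1) * g.1 (Heis.ofVec h.vec.2)), by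
    constructor
    · intro z h
      have h1 : (Heis.ofCenter (V.prod W) z * h).z = z + h.z := by simp [Heis.ofCenter]
      have h2 : (Heis.ofCenter (V.prod W) z * h).vec = h.vec := zero_add _
      simp only [h1, h2, AddChar.map_add_eq_mul, mul_assoc]
    · rintro ⟨l, m⟩ ⟨hl, hm⟩ ⟨⟨v, w⟩, z⟩
      have h1 := f.2.2 l hl (Heis.ofVec v)
      have h2 := g.2.2 m hm (Heis.ofVec w)
      rw [model_apply_ofVec_mul] at h1 h2
      change ψ (0 + z + 2⁻¹ * (V.form l v + W.form m w)) *
        (f.1 (Heis.ofVec (l + v)) * g.1 (Heis.ofVec (m + w))) =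
          ψ z * (f.1 (Heis.ofVec v) * g.1 (Heis.ofVec w))
      rw [← h1, ← h2, zero_add, mul_add, AddChar.map_add_eq_mul, AddChar.map_add_eq_mul]
      ring⟩

/-- The bilinear map `(f, g) ↦ f ⊠ g` between the models. -/
def boxProd {V W : Symp F} (L : OLag V) (M : OLag W) :
    model ψ V L.space →ₗ[ℂ] model ψ W M.space →ₗ[ℂ] model ψ (V.prod W) (L.prod M).space :=
  LinearMap.mk₂ ℂ boxProdFun
    (fun f f' g => Subtype.ext <| funext fun h => by
      change ψ h.z * ((f.1 _ + f'.1 _) * g.1 _) = ψ h.z * (f.1 _ * g.1 _) + ψ h.z * (f'.1 _ * g.1 _)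
      ring)
    (fun c f g => Subtype.ext <| funext fun h => by
      change ψ h.z * (c * f.1 _ * g.1 _) = c * (ψ h.z * (f.1 _ * g.1 _))
      ring)
    (fun f g g' => Subtype.ext <| funext fun h => by
      change ψ h.z * (f.1 _ * (g.1 _ + g'.1 _)) = ψ h.z * (f.1 _ * g.1 _) + ψ h.z * (f.1 _ * g'.1 _)
      ring)
    (fun c f g => Subtype.ext <| funext fun h => by
      change ψ h.z * (f.1 _ * (c * g.1 _)) = c * (ψ h.z * (f.1 _ * g.1 _))
      ring)

theorem boxProd_apply {V W : Symp F} {L : OLag V} {M : OLag W}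
    (f : model ψ V L.space) (g : model ψ W M.space) (h : Heis (V.prod W)) :
    (boxProd L M f g).1 h = ψ h.z * (f.1 (Heis.ofVec h.vec.1) * g.1 (Heis.ofVec h.vec.2)) := rfl

theorem boxProd_apply_ofVec {V W : Symp F} {L : OLag V} {M : OLag W} (f : model ψ V L.space)
    (g : model ψ W M.space) (v : V.carrier) (w : W.carrier) :
    (boxProd L M f g).1 (Heis.ofVec (prodVec v w)) =
      f.1 (Heis.ofVec v) * g.1 (Heis.ofVec w) := by
  rw [boxProd_apply]
  change ψ 0 * _ = _
  rw [AddChar.map_zero_eq_one, one_mul]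
  rfl

theorem model_prod_ext {V W : Symp F} {L : Submodule F (V.prod W).carrier}
    {f g : model ψ (V.prod W) L}
    (h : ∀ v w, f.1 (Heis.ofVec (prodVec v w)) = g.1 (Heis.ofVec (prodVec v w))) : f = g :=
  model_ext fun x => h x.1 x.2

theorem exists_apply_ofVec_ne_zero {V : Symp F} {L : Submodule F V.carrier} {f : model ψ V L}
    (hf : f ≠ 0) : ∃ v, f.1 (Heis.ofVec v) ≠ 0 := by
  by_contra hcon
  push Not at hcon
  exact hf (model_ext fun w => hcon w)

/-- Evaluate the second variable at a point where g does not vanish. This is how identities descend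
from the doubled space. -/
theorem eq_of_boxProd_eq {V W : Symp F} {L : OLag V} {M : OLag W}
    {f f' : model ψ V L.space} {g : model ψ W M.space} (hg : g ≠ 0)
    (h : boxProd L M f g = boxProd L M f' g) : f = f' := by
  obtain ⟨w, hw⟩ := exists_apply_ofVec_ne_zero hg
  refine model_ext fun v => ?_
  have := congrFun (congrArg Subtype.val h) (Heis.ofVec (prodVec v w))
  rw [boxProd_apply_ofVec, boxProd_apply_ofVec] at this
  exact mul_right_cancel₀ hw this

theorem averaging_apply_ofVec {V : Symp F} {L : Submodule F V.carrier} (M : Submodule F V.carrier)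
    [Fintype M] (f : model ψ V L) (v : V.carrier) : averaging M f.1 (Heis.ofVec v) =
      ∑ m : M, ψ (2⁻¹ * V.form m v) * f.1 (Heis.ofVec (m + v)) := by
  rw [averaging_eq_sum]
  exact Finset.sum_congr rfl fun m _ => model_apply_ofVec_mul f _ _

variable [Fintype F]

/-- The form on the product is a sum, so the cocycle ψ(½ ω) splits and the sum over M × M' factors.
-/
theorem averaging_boxProd {V W : Symp F} {L M : OLag V} {L' M' : OLag W}
    (f : model ψ V L.space) (g : model ψ W L'.space) (v : V.carrier) (w : W.carrier) :
    averaging (M.prod M').space (boxProd L L' f g).1 (Heis.ofVec (prodVec v w)) =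
      averaging M.space f.1 (Heis.ofVec v) * averaging M'.space g.1 (Heis.ofVec w) := by
  have := Fintype.ofFinite M.space
  have := Fintype.ofFinite M'.space
  let i : Fintype (prodSpace M.space M'.space) := Fintype.ofFinite _
  let _ : Fintype (M.prod M').space := i
  rw [averaging_apply_ofVec, averaging_apply_ofVec, averaging_apply_ofVec,
    Fintype.sum_mul_sum, ← Fintype.sum_prod_type']
  refine (Fintype.sum_equiv (prodSpaceEquiv M.space M'.space).toEquiv _ _ ?_).symm
  rintro ⟨m, m'⟩
  change _ = ψ (2⁻¹ * (V.form m v + W.form m' w)) * (boxProd L L' f g).1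
    (Heis.ofVec (prodVec ((m : V.carrier) + v) ((m' : W.carrier) + w)))
  rw [boxProd_apply_ofVec, mul_add, AddChar.map_add_eq_mul]
  ring

variable [DecidableEq F]

theorem averagingOp_boxProd {V W : Symp F} (M L : OLag V) (M' L' : OLag W)
    (f : model ψ V L.space) (g : model ψ W L'.space) :
    averagingOp ψ (M.prod M') (L.prod L') (boxProd L L' f g) =
      boxProd M M' (averagingOp ψ M L f) (averagingOp ψ M' L' g) := by
  refine model_prod_ext fun v w => ?_
  rw [boxProd_apply_ofVec, averagingOp_apply, averagingOp_apply, averagingOp_apply,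
    normalization_prod, averaging_boxProd]
  ring

end BoxProd

/-! ### Doubling -/

/-- The symplectic space `(V, -ω)`. -/
def Symp.neg (V : Symp F) : Symp F where
  carrier := V.carrier
  form := -V.form
  form_alt := V.form_alt.neg
  form_nondeg := by
    constructor
    · exact fun x h => V.form_nondeg.1 x fun y => neg_eq_zero.1 (h y)
    · exact fun x h => V.form_nondeg.2 x fun y => neg_eq_zero.1 (h y)

/-- An oriented Lagrangian of `(V, ω)`, as an oriented Lagrangian of `(V, -ω)`. -/
def OLag.neg {V : Symp F} (L : OLag V) : OLag V.neg where
  space := L.space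
  isLagrangian := by
    refine Submodule.ext fun x => ?_
    refine LinearMap.BilinForm.mem_orthogonal_iff.trans
      (Iff.trans ?_ (L.isLagrangian.mem_iff x).symm)
    exact forall₂_congr fun y _ => neg_eq_zero
  orient := L.orient
  orient_mem := L.orient_mem
  orient_ne_zero := L.orient_ne_zero

theorem OLag.Transversal.neg {V : Symp F} {L M : OLag V} (h : L.Transversal M) :
    L.neg.Transversal M.neg := h

/-- The diagonal of `V × V`. -/
def diagonal (V : Symp F) : Submodule F (V.prod V.neg).carrier :=
  LinearMap.range ((LinearMap.id : V.carrier →ₗ[F] V.carrier).prod LinearMap.id)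

theorem diagonal_isLagrangian (V : Symp F) : IsLagrangian (V.prod V.neg) (diagonal V) := by
  refine Submodule.ext fun x => ?_
  rw [LinearMap.BilinForm.mem_orthogonal_iff]
  obtain ⟨x, (y : V.carrier)⟩ := x
  constructor
  · intro h
    have h1 : ∀ v : V.carrier, V.form v (x - y) = 0 := by
      intro v
      have h2 : V.form v x + -V.form v y = 0 := h (v, v) ⟨v, rfl⟩
      rw [map_sub, sub_eq_add_neg, h2]
    exact ⟨x, Prod.ext rfl (sub_eq_zero.1 (V.form_nondeg.2 _ h1))⟩
  · rintro ⟨v, hv⟩ _ ⟨w, rfl⟩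
    obtain ⟨rfl, rfl⟩ : v = x ∧ v = y := Prod.ext_iff.1 hv
    exact add_neg_cancel (V.form w v)

/-- The diagonal of `V × V`, with some orientation. -/
def diagonalOLag (V : Symp F) : OLag (V.prod V.neg) := (diagonal_isLagrangian V).exists_oLag.choose

/-- A diagonal vector (v, v) lies in L × M only if v ∈ L ∩ M. Transversality of a pair in V thus
becomes transversality to one fixed Lagrangian. -/
theorem diagonalOLag_transversal {V : Symp F} {L M : OLag V} (h : L.Transversal M) :
    (diagonalOLag V).Transversal (L.prod M.neg) := by
  rw [OLag.transversal_iff] at h ⊢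
  rw [show (diagonalOLag V).space = diagonal V from
    (diagonal_isLagrangian V).exists_oLag.choose_spec]
  refine (Submodule.eq_bot_iff _).2 ?_
  rintro _ ⟨⟨v, rfl⟩, h1, h2⟩
  have := (Submodule.eq_bot_iff _).1 h v ⟨h1, h2⟩
  exact Prod.ext this this

/-! ### Delta functions and independence of the path -/

section Canonical

variable {ψ : AddChar F ℂ}

theorem Symp.form_eq_of_sub_mem (V : Symp F) {L : Submodule F V.carrier} (hL : IsLagrangian V L)
    {l v w : V.carrier} (hl : l ∈ L) (hvw : v - w ∈ L) :
    V.form l v = V.form l w := by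
  have := hL.form_eq_zero hl hvw
  rwa [map_sub, sub_eq_zero] at this

open Classical in
/-- The function in the model `ℋ_L` supported on the coset of `(w, 0)` with value `1` there. -/
def deltaFun (ψ : AddChar F ℂ) {V : Symp F} {L : Submodule F V.carrier} (hL : IsLagrangian V L)
    (w : V.carrier) : model ψ V L :=
  ⟨fun h => if h.vec - w ∈ L then ψ (h.z - 2⁻¹ * V.form h.vec w) else 0, by
    constructor
    · intro z h
      simp only [Heis.ofCenter, Heis.mul_vec, Heis.mul_z, zero_add, map_zero,
        LinearMap.zero_apply, mul_zero, add_zero, mul_ite]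
      simp only [add_sub_assoc, AddChar.map_add_eq_mul]
    · intro l hl h
      have h1 : l + h.vec - w ∈ L ↔ h.vec - w ∈ L := by
        rw [add_sub_assoc]
        exact Submodule.add_mem_iff_right _ hl
      simp only [Heis.ofVec, Heis.mul_vec, Heis.mul_z, zero_add, h1]
      refine if_ctx_congr Iff.rfl (fun h2 => ?_) fun _ => rfl
      -- On the support ω(l, v) = ω(l, w), so the cocycle of the product cancels the change in the
      -- exponent.
      rw [map_add, LinearMap.add_apply, V.form_eq_of_sub_mem hL hl h2]
      congr 1
      ring⟩

theorem deltaFun_apply_self {V : Symp F} {L : Submodule F V.carrier} (hL : IsLagrangian V L)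
    (w : V.carrier) : (deltaFun ψ hL w).1 (Heis.ofVec w) = 1 := by
  simp [deltaFun, Heis.ofVec, show V.form w w = 0 from V.form_alt w]

theorem deltaFun_apply_of_notMem {V : Symp F} {L : Submodule F V.carrier}
    (hL : IsLagrangian V L) {v w : V.carrier} (h : v - w ∉ L) :
    (deltaFun ψ hL w).1 (Heis.ofVec v) = 0 := if_neg h

theorem deltaFun_ne_zero {V : Symp F} {L : Submodule F V.carrier} (hL : IsLagrangian V L)
    (w : V.carrier) : deltaFun ψ hL w ≠ 0 := by
  intro h
  have := deltaFun_apply_self (ψ := ψ) hL w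
  rw [h] at this
  exact zero_ne_one this

variable [Fintype F] [DecidableEq F]

theorem averagingOp_ne_zero (hF : ringChar F ≠ 2) (hψ : ψ ≠ 1) {V : Symp F}
    {M L : OLag V} (h : M.Transversal L) {f : model ψ V L.space} (hf : f ≠ 0) :
    averagingOp ψ M L f ≠ 0 := by
  intro h0
  have := averagingOp_averagingOp_self hF hψ h f
  rw [h0, map_zero] at this
  exact hf this.symm

/-- Two paths in the graph of transversal Lagrangians are filled by triangles if there is a
Lagrangian transversal to all vertices. -/
theorem averagingOp_path_eq (hF : ringChar F ≠ 2) (hψ : ψ ≠ 1) {V : Symp F}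
    {X Y Z D : OLag V} (hX : D.Transversal X) (hY : D.Transversal Y) (hZ : D.Transversal Z)
    (hZX : Z.Transversal X) (hZY : Z.Transversal Y) (f : model ψ V X.space) :
    averagingOp ψ Y Z (averagingOp ψ Z X f) = averagingOp ψ Y D (averagingOp ψ D X f) := by
  rw [← averagingOp_averagingOp hF hψ hZ.symm hX hZX, averagingOp_averagingOp hF hψ hZY.symm
    hZ.symm hY.symm]

/-- The composition along a path of length two does not depend on the path. -/
theorem averagingOp_averagingOp_eq (hF : ringChar F ≠ 2) (hψ : ψ ≠ 1) {V : Symp F}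
    {L N M M' : OLag V} (hML : M.Transversal L) (hMN : M.Transversal N) (hM'L : M'.Transversal L)
    (hM'N : M'.Transversal N) (f : model ψ V L.space) :
    averagingOp ψ N M (averagingOp ψ M L f) = averagingOp ψ N M' (averagingOp ψ M' L f) := by
  -- In the doubled space both paths run from L × M⁻ to N × M⁻, one through M × L⁻ and the other
  -- through M' × Q⁻. The diagonal is transversal to all four Lagrangians, the last because Q is
  -- transversal to M'.
  obtain ⟨Q, hQM, hQM'⟩ := M.exists_transversal M'
  have hX := diagonalOLag_transversal hML.symm
  have hY := diagonalOLag_transversal hMN.symm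
  have hZ := diagonalOLag_transversal hML
  have hZ' := diagonalOLag_transversal hQM'.symm
  set g := deltaFun ψ M.neg.isLagrangian 0
  have hg : g ≠ 0 := deltaFun_ne_zero _ _
  have h1 := averagingOp_path_eq hF hψ hX hY hZ (OLag.prod_transversal hML hML.symm.neg)
    (OLag.prod_transversal hMN hML.symm.neg) (boxProd L M.neg f g)
  have h2 := averagingOp_path_eq hF hψ hX hY hZ' (OLag.prod_transversal hM'L hQM.neg)
    (OLag.prod_transversal hM'N hQM.neg) (boxProd L M.neg f g)
  -- In the second factor both paths go from M⁻ to a transversal and back, which is the identity on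
  -- g.
  rw [← h2, averagingOp_boxProd, averagingOp_boxProd, averagingOp_boxProd, averagingOp_boxProd,
    averagingOp_averagingOp_self hF hψ hML.symm.neg, averagingOp_averagingOp_self hF hψ hQM.neg]
    at h1
  exact eq_of_boxProd_eq hg h1

/-! ### The canonical trivialization -/

variable (ψ) in
/-- The canonical intertwining map between the models of two arbitrary Lagrangians. -/
def canonicalOp {V : Symp F} (N L : OLag V) : model ψ V L.space →ₗ[ℂ] model ψ V N.space :=
  averagingOp ψ N (L.exists_transversal N).choose ∘ₗ
    averagingOp ψ (L.exists_transversal N).choose L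

theorem canonicalOp_eq (hF : ringChar F ≠ 2) (hψ : ψ ≠ 1) {V : Symp F} {N L P : OLag V}
    (hPL : P.Transversal L) (hPN : P.Transversal N) (f : model ψ V L.space) :
    canonicalOp ψ N L f = averagingOp ψ N P (averagingOp ψ P L f) :=
  averagingOp_averagingOp_eq hF hψ (L.exists_transversal N).choose_spec.1
    (L.exists_transversal N).choose_spec.2 hPL hPN f

theorem canonicalOp_self (hF : ringChar F ≠ 2) (hψ : ψ ≠ 1) {V : Symp F} (L : OLag V)
    (f : model ψ V L.space) : canonicalOp ψ L L f = f := by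
  obtain ⟨P, hP, -⟩ := L.exists_transversal L
  rw [canonicalOp_eq hF hψ hP hP, averagingOp_averagingOp_self hF hψ hP]

theorem canonicalOp_of_transversal (hF : ringChar F ≠ 2) (hψ : ψ ≠ 1) {V : Symp F}
    {N L : OLag V} (h : N.Transversal L) (f : model ψ V L.space) :
    canonicalOp ψ N L f = averagingOp ψ N L f := by
  obtain ⟨P, hPL, hPN⟩ := L.exists_transversal N
  rw [canonicalOp_eq hF hψ hPL hPN, averagingOp_averagingOp hF hψ hPN.symm hPL h]

theorem canonicalOp_boxProd (hF : ringChar F ≠ 2) (hψ : ψ ≠ 1) {V W : Symp F} (N L : OLag V)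
    (N' L' : OLag W) (f : model ψ V L.space) (g : model ψ W L'.space) :
    canonicalOp ψ (N.prod N') (L.prod L') (boxProd L L' f g) =
      boxProd N N' (canonicalOp ψ N L f) (canonicalOp ψ N' L' g) := by
  obtain ⟨P, hPL, hPN⟩ := L.exists_transversal N
  obtain ⟨Q, hQL, hQN⟩ := L'.exists_transversal N'
  rw [canonicalOp_eq hF hψ hPL hPN, canonicalOp_eq hF hψ hQL hQN,
    canonicalOp_eq hF hψ (OLag.prod_transversal hPL hQL) (OLag.prod_transversal hPN hQN),
    averagingOp_boxProd, averagingOp_boxProd]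

/-- With Q transversal to N and R transversal to M and L, the diagonal is transversal to N × Q⁻, M ×
R⁻ and L × R⁻. Hence all three operators in V × V⁻ may be computed through it, and the middle return
trip cancels. -/
theorem canonicalOp_canonicalOp (hF : ringChar F ≠ 2) (hψ : ψ ≠ 1) {V : Symp F} (N M L : OLag V)
    (f : model ψ V L.space) :
    canonicalOp ψ N M (canonicalOp ψ M L f) = canonicalOp ψ N L f := by
  obtain ⟨Q, hQM, hQN⟩ := M.exists_transversal N
  obtain ⟨R, hRM, hRL⟩ := M.exists_transversal L
  obtain ⟨P, hPQ, hPR⟩ := Q.exists_transversal R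
  have hX := diagonalOLag_transversal hQN.symm
  have hY := diagonalOLag_transversal hRM.symm
  have hZ := diagonalOLag_transversal hRL.symm
  set g := deltaFun ψ R.neg.isLagrangian 0
  -- The common transversal P of Q and R exhibits this operator as a composite of two injective
  -- ones, so the second factor can be cancelled.
  have hg : canonicalOp ψ Q.neg R.neg g ≠ 0 := by
    rw [canonicalOp_eq hF hψ hPR.neg hPQ.neg]
    exact averagingOp_ne_zero hF hψ hPQ.symm.neg
      (averagingOp_ne_zero hF hψ hPR.neg (deltaFun_ne_zero _ _))
  refine eq_of_boxProd_eq hg ?_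
  calc boxProd N Q.neg (canonicalOp ψ N M (canonicalOp ψ M L f)) (canonicalOp ψ Q.neg R.neg g)
      = canonicalOp ψ (N.prod Q.neg) (M.prod R.neg)
          (canonicalOp ψ (M.prod R.neg) (L.prod R.neg) (boxProd L R.neg f g)) := by
        rw [canonicalOp_boxProd hF hψ, canonicalOp_boxProd hF hψ,
          canonicalOp_self hF hψ R.neg]
    _ = canonicalOp ψ (N.prod Q.neg) (L.prod R.neg) (boxProd L R.neg f g) := by
        rw [canonicalOp_eq hF hψ hZ hY, canonicalOp_eq hF hψ hY hX,
          averagingOp_averagingOp_self hF hψ hY.symm, canonicalOp_eq hF hψ hZ hX]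
    _ = _ := canonicalOp_boxProd hF hψ _ _ _ _ _ _

/-- The canonical trivialization. -/
def canonicalSystem (hF : ringChar F ≠ 2) (hψ : ψ ≠ 1) (V : Symp F) : IntertwiningSystem ψ V :=
  fun M L => LinearEquiv.ofLinearMap (canonicalOp ψ M L) (canonicalOp ψ L M)
    (LinearMap.ext fun f => (canonicalOp_canonicalOp hF hψ M L M f).trans
      (canonicalOp_self hF hψ M f))
    (LinearMap.ext fun f => (canonicalOp_canonicalOp hF hψ L M L f).trans
      (canonicalOp_self hF hψ L f))

theorem canonicalSystem_isCanonicalSystem (hF : ringChar F ≠ 2) (hψ : ψ ≠ 1) (V : Symp F) :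
    IsCanonicalSystem ψ V (canonicalSystem hF hψ V) where
  intertwines M L h f := by
    change canonicalOp ψ M L _ = modelRep ψ V _ h (canonicalOp ψ M L f)
    obtain ⟨P, hPL, hPM⟩ := L.exists_transversal M
    rw [canonicalOp_eq hF hψ hPL hPM, canonicalOp_eq hF hψ hPL hPM, averagingOp_modelRep,
      averagingOp_modelRep]
  multiplicative N M L f := canonicalOp_canonicalOp hF hψ N M L f
  ansatz M L h f x := congrFun (congrArg Subtype.val (canonicalOp_of_transversal hF hψ h f)) x

/-- Multiplicativity factors every T_{M,L} through a common transversal, and the values on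
transversal pairs are prescribed. -/
theorem IsCanonicalSystem.apply_eq {V : Symp F} {T T' : IntertwiningSystem ψ V}
    (hT : IsCanonicalSystem ψ V T) (hT' : IsCanonicalSystem ψ V T') (M L : OLag V)
    (f : model ψ V L.space) : T M L f = T' M L f := by
  have key : ∀ (M L : OLag V), M.Transversal L → ∀ f, T M L f = T' M L f := by
    intro M L h f
    ext x
    rw [hT.ansatz M L h, hT'.ansatz M L h]
  obtain ⟨P, hPL, hPM⟩ := L.exists_transversal M
  rw [← hT.multiplicative M P L, ← hT'.multiplicative M P L, key _ _ hPL, key _ _ hPM.symm]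

theorem existsUnique_isCanonicalSystem (hF : ringChar F ≠ 2) (hψ : ψ ≠ 1) (V : Symp F) :
    ∃! T : IntertwiningSystem ψ V, IsCanonicalSystem ψ V T :=
  ⟨canonicalSystem hF hψ V, canonicalSystem_isCanonicalSystem hF hψ V, fun _ hT =>
    funext fun M => funext fun L => LinearEquiv.ext fun f =>
      hT.apply_eq (canonicalSystem_isCanonicalSystem hF hψ V) M L f⟩

end Canonical

/-! ### Evaluation of horizontal sections -/

section Monoidal

/-- Since V = L + C, left L-invariance recovers f from its values on C, up to values of ψ. -/
theorem model_eq_zero_of_transversal {ψ : AddChar F ℂ} {V : Symp F} {L C : OLag V}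
    (h : C.Transversal L) {f : model ψ V L.space}
    (hf : ∀ c ∈ C.space, f.1 (Heis.ofVec c) = 0) : f = 0 := by
  refine model_ext fun v => ?_
  obtain ⟨l, hl, c, hc, rfl⟩ := Submodule.mem_sup.1
    ((show L.space ⊔ C.space = ⊤ from h) ▸ Submodule.mem_top : v ∈ L.space ⊔ C.space)
  have h1 := f.2.2 l hl (Heis.ofVec c)
  rw [model_apply_ofVec_mul, hf c hc] at h1
  exact (mul_eq_zero.1 h1).resolve_left (ψ.val_isUnit _).ne_zero

variable [Fintype F] {ψ : AddChar F ℂ}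

variable (ψ) in
/-- Restriction of the functions in the model `ℋ_L` to another Lagrangian. -/
def restriction {V : Symp F} (L C : OLag V) : model ψ V L.space →ₗ[ℂ] (C.space → ℂ) where
  toFun f c := f.1 (Heis.ofVec (c : V.carrier))
  map_add' _ _ := rfl
  map_smul' _ _ := rfl

/-- C represents each coset of L once, so the delta functions at its points restrict to the standard
basis. -/
theorem restriction_bijective {V : Symp F} {L C : OLag V} (h : C.Transversal L) :
    Function.Bijective (restriction ψ L C) := by
  constructor
  · rw [← LinearMap.ker_eq_bot, LinearMap.ker_eq_bot']
    intro f hf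
    exact model_eq_zero_of_transversal h fun c hc => congrFun hf ⟨c, hc⟩
  · intro a
    have := Fintype.ofFinite C.space
    refine ⟨∑ c : C.space, a c • deltaFun ψ L.isLagrangian (c : V.carrier), funext fun d => ?_⟩
    rw [map_sum, Finset.sum_apply, Finset.sum_eq_single d]
    · change a d * (deltaFun ψ L.isLagrangian (d : V.carrier)).1 _ = _
      rw [deltaFun_apply_self, mul_one]
    · intro c _ hcd
      change a c * (deltaFun ψ L.isLagrangian (c : V.carrier)).1 _ = 0
      rw [deltaFun_apply_of_notMem, mul_zero]
      intro hmem
      rw [OLag.transversal_iff] at h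
      exact hcd (Subtype.ext (sub_eq_zero.1 ((Submodule.eq_bot_iff _).1 h _
        ⟨C.space.sub_mem d.2 c.2, hmem⟩)).symm)
    · simp

variable (ψ) in
/-- The model `ℋ_L` is the space of functions on a Lagrangian transversal to `L`. -/
def restrictionEquiv {V : Symp F} {L C : OLag V} (h : C.Transversal L) :
    model ψ V L.space ≃ₗ[ℂ] (C.space → ℂ) :=
  LinearEquiv.ofBijective (restriction ψ L C) (restriction_bijective h)

theorem restrictionEquiv_apply {V : Symp F} {L C : OLag V} (h : C.Transversal L)
    (f : model ψ V L.space) (c : C.space) :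
    restrictionEquiv ψ h f c = f.1 (Heis.ofVec (c : V.carrier)) := rfl

/-- The tensor product of the models of `L` and `M` is the model of `L × M`. -/
theorem lift_boxProd_bijective {V W : Symp F} (L : OLag V) (M : OLag W) :
    Function.Bijective (TensorProduct.lift (boxProd (ψ := ψ) L M)) := by
  obtain ⟨C, hC, -⟩ := L.exists_transversal L
  obtain ⟨D, hD, -⟩ := M.exists_transversal M
  have := Fintype.ofFinite D.space
  classical
  let e : TensorProduct ℂ (model ψ V L.space) (model ψ W M.space) ≃ₗ[ℂ]
      (D.space → C.space → ℂ) :=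
    (TensorProduct.congr (restrictionEquiv ψ hC) (restrictionEquiv ψ hD)).trans
      (TensorProduct.piScalarRight ℂ ℂ (C.space → ℂ) D.space)
  -- The factors are swapped because `TensorProduct.piScalarRight` puts the variable of the second
  -- tensor factor outermost.
  let e' : model ψ (V.prod W) (L.prod M).space ≃ₗ[ℂ] (D.space → C.space → ℂ) :=
    (restrictionEquiv ψ (OLag.prod_transversal hC hD)).trans
      ((LinearEquiv.funCongrLeft ℂ ℂ ((Equiv.prodComm D.space C.space).trans
        (prodSpaceEquiv C.space D.space).toEquiv)).trans
          (LinearEquiv.curry ℂ ℂ D.space C.space))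
  have key : e'.toLinearMap ∘ₗ TensorProduct.lift (boxProd L M) = e.toLinearMap := by
    refine TensorProduct.ext' fun f g => ?_
    refine funext fun d => funext fun c => ?_
    simp only [e, LinearMap.comp_apply, TensorProduct.lift.tmul, LinearEquiv.coe_coe,
      LinearEquiv.trans_apply, TensorProduct.congr_tmul, TensorProduct.piScalarRight_apply,
      TensorProduct.piScalarRightHom_tmul, Pi.smul_apply, smul_eq_mul, restrictionEquiv_apply]
    exact (boxProd_apply_ofVec f g c d).trans (mul_comm _ _)
  have h : TensorProduct.lift (boxProd L M) = (e.trans e'.symm).toLinearMap := by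
    rw [LinearEquiv.coe_trans, ← key, ← LinearMap.comp_assoc]
    ext1
    simp
  rw [h]
  exact (e.trans e'.symm).bijective

variable [DecidableEq F]

theorem CanonicalSpace.canonicalOp_apply (hF : ringChar F ≠ 2) (hψ : ψ ≠ 1) {V : Symp F}
    (v : CanonicalSpace ψ V) (M L : OLag V) : canonicalOp ψ M L (v.1 L) = v.1 M :=
  v.2 _ (canonicalSystem_isCanonicalSystem hF hψ V) M L

/-- Evaluation of a horizontal section at an oriented Lagrangian. -/
def evalEquiv (hF : ringChar F ≠ 2) (hψ : ψ ≠ 1) {V : Symp F} (L : OLag V) :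
    CanonicalSpace ψ V ≃ₗ[ℂ] model ψ V L.space where
  toFun v := v.1 L
  invFun f := ⟨fun M => canonicalOp ψ M L f, fun T hT N M => by
    rw [hT.apply_eq (canonicalSystem_isCanonicalSystem hF hψ V)]
    exact canonicalOp_canonicalOp hF hψ N M L f⟩
  map_add' _ _ := rfl
  map_smul' _ _ := rfl
  left_inv v := Subtype.ext (funext fun M => v.canonicalOp_apply hF hψ M L)
  right_inv f := canonicalOp_self hF hψ L f

/-- Evaluation at one Lagrangian is injective; each coherence identity is therefore checked at one
conveniently chosen L. -/
theorem CanonicalSpace.ext_of_apply_eq (hF : ringChar F ≠ 2) (hψ : ψ ≠ 1) {V : Symp F}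
    {v w : CanonicalSpace ψ V} (L : OLag V) (h : ∀ x, (v.1 L).1 x = (w.1 L).1 x) : v = w :=
  (evalEquiv hF hψ L).injective (Subtype.ext (funext h))

/-- The components at L and L' have different types when L = L' is only a proved equality, so their
values are compared. -/
theorem CanonicalSpace.apply_congr {V : Symp F} (v : CanonicalSpace ψ V) {L L' : OLag V}
    (h : L = L') (x : Heis V) : (v.1 L).1 x = (v.1 L').1 x := by
  subst h
  rfl

/-! ### The monoidal structure -/

/-- The isomorphism `ℋ(V) ⊗ ℋ(W) ≃ ℋ(V × W)`. -/
def tensorEquiv (hF : ringChar F ≠ 2) (hψ : ψ ≠ 1) (V W : Symp F) :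
    TensorProduct ℂ (CanonicalSpace ψ V) (CanonicalSpace ψ W) ≃ₗ[ℂ]
      CanonicalSpace ψ (V.prod W) :=
  (TensorProduct.congr (evalEquiv hF hψ (Classical.arbitrary (OLag V)))
    (evalEquiv hF hψ (Classical.arbitrary (OLag W)))).trans
      ((LinearEquiv.ofBijective _ (lift_boxProd_bijective _ _)).trans
        (evalEquiv hF hψ ((Classical.arbitrary (OLag V)).prod
          (Classical.arbitrary (OLag W)))).symm)

/-- The chosen Lagrangians disappear because the canonical operators respect ⊠ and horizontal
sections are fixed by them. -/
theorem tensorEquiv_tmul_apply (hF : ringChar F ≠ 2) (hψ : ψ ≠ 1) {V W : Symp F}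
    (v : CanonicalSpace ψ V) (w : CanonicalSpace ψ W) (L : OLag V) (M : OLag W) :
    (tensorEquiv hF hψ V W (v ⊗ₜ w)).1 (L.prod M) = boxProd L M (v.1 L) (w.1 M) := by
  change canonicalOp ψ (L.prod M) ((Classical.arbitrary (OLag V)).prod
    (Classical.arbitrary (OLag W))) (boxProd _ _ (v.1 _) (w.1 _)) = _
  rw [canonicalOp_boxProd hF hψ, v.canonicalOp_apply hF hψ, w.canonicalOp_apply hF hψ]

theorem tensorEquiv_tmul_apply_apply (hF : ringChar F ≠ 2) (hψ : ψ ≠ 1) {V W : Symp F}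
    (v : CanonicalSpace ψ V) (w : CanonicalSpace ψ W) (L : OLag V) (M : OLag W)
    (h : Heis (V.prod W)) : ((tensorEquiv hF hψ V W (v ⊗ₜ w)).1 (L.prod M)).1 h =
      ψ h.z * ((v.1 L).1 (Heis.ofVec h.vec.1) * (w.1 M).1 (Heis.ofVec h.vec.2)) := by
  rw [tensorEquiv_tmul_apply, boxProd_apply]

end Monoidal

/-! ### Product orientations compared in the ambient exterior algebra -/

section Ambient

/-- The orientation of `L` as an element of the exterior algebra of `V`. -/
def OLag.ambient {V : Symp F} (L : OLag V) : ExteriorAlgebra F V.carrier :=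
  ExteriorAlgebra.map L.space.subtype L.orient

theorem exteriorAlgebra_map_map {A B C : Type} [AddCommGroup A] [Module F A] [AddCommGroup B]
    [Module F B] [AddCommGroup C] [Module F C] (f : A →ₗ[F] B) (g : B →ₗ[F] C)
    (x : ExteriorAlgebra F A) : ExteriorAlgebra.map g (ExteriorAlgebra.map f x) =
      ExteriorAlgebra.map (g ∘ₗ f) x :=
  AlgHom.congr_fun (ExteriorAlgebra.map_comp_map f g) x

theorem OLag.ambient_map {V W : Symp F} (f : Hom V W) (L : OLag V) :
    (L.map f).ambient = ExteriorAlgebra.map (f.toEquiv : V.carrier →ₗ[F] W.carrier) L.ambient := by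
  rw [OLag.ambient, OLag.map_subtype_orient, OLag.ambient, exteriorAlgebra_map_map]

/-- The inclusion `V → V × W`. -/
def prodInl (V W : Symp F) : V.carrier →ₗ[F] (V.prod W).carrier :=
  LinearMap.inl F V.carrier W.carrier

/-- The inclusion `W → V × W`. -/
def prodInr (V W : Symp F) : W.carrier →ₗ[F] (V.prod W).carrier :=
  LinearMap.inr F V.carrier W.carrier

theorem OLag.ambient_prod {V W : Symp F} (L : OLag V) (M : OLag W) :
    (L.prod M).ambient = ExteriorAlgebra.map (prodInl V W) L.ambient *
      ExteriorAlgebra.map (prodInr V W) M.ambient := by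
  rw [OLag.ambient, OLag.ambient, OLag.ambient, exteriorAlgebra_map_map, exteriorAlgebra_map_map]
  change ExteriorAlgebra.map _ (ExteriorAlgebra.map (prodSpaceInl L.space M.space) L.orient *
    ExteriorAlgebra.map (prodSpaceInr L.space M.space) M.orient) = _
  rw [map_mul]
  exact congrArg₂ _ (exteriorAlgebra_map_map _ _ _) (exteriorAlgebra_map_map _ _ _)

theorem OLag.prod_map {V V' W W' : Symp F} (f : Hom V V') (g : Hom W W') (L : OLag V)
    (M : OLag W) : (L.prod M).map (Hom.prodMap f g) = (L.map f).prod (M.map g) := by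
  refine OLag.ext_of_map ?_ ?_
  · refine Submodule.ext fun x => ?_
    constructor
    · rintro ⟨y, hy, rfl⟩
      exact ⟨⟨y.1, hy.1, rfl⟩, ⟨y.2, hy.2, rfl⟩⟩
    · rintro ⟨⟨y, hy, h1⟩, ⟨z, hz, h2⟩⟩
      exact ⟨(y, z), ⟨hy, hz⟩, Prod.ext h1 h2⟩
  · change OLag.ambient _ = OLag.ambient _
    rw [OLag.ambient_map, OLag.ambient_prod, OLag.ambient_prod, OLag.ambient_map,
      OLag.ambient_map, map_mul, exteriorAlgebra_map_map, exteriorAlgebra_map_map,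
      exteriorAlgebra_map_map, exteriorAlgebra_map_map]
    have h1 : (↑(Hom.prodMap f g).toEquiv : (V.prod W).carrier →ₗ[F] (V'.prod W').carrier) ∘ₗ
        prodInl V W = prodInl V' W' ∘ₗ (f.toEquiv : V.carrier →ₗ[F] V'.carrier) :=
      LinearMap.ext fun v => Prod.ext rfl (map_zero g.toEquiv)
    have h2 : (↑(Hom.prodMap f g).toEquiv : (V.prod W).carrier →ₗ[F] (V'.prod W').carrier) ∘ₗ
        prodInr V W = prodInr V' W' ∘ₗ (g.toEquiv : W.carrier →ₗ[F] W'.carrier) :=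
      LinearMap.ext fun v => Prod.ext (map_zero f.toEquiv) rfl
    rw [h1, h2]

/-- The exterior product is associative and the order of the factors is kept, so no sign intervenes.
-/
theorem OLag.prod_map_assoc_symm {U V W : Symp F} (L : OLag U) (M : OLag V) (N : OLag W) :
    (L.prod (M.prod N)).map (assocHom U V W).symm = (L.prod M).prod N := by
  refine OLag.ext_of_map ?_ ?_
  · refine Submodule.ext fun x => ?_
    constructor
    · rintro ⟨y, hy, rfl⟩
      exact ⟨⟨hy.1, hy.2.1⟩, hy.2.2⟩
    · rintro ⟨⟨h1, h2⟩, h3⟩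
      exact ⟨(x.1.1, (x.1.2, x.2)), ⟨h1, h2, h3⟩, rfl⟩
  · change OLag.ambient _ = OLag.ambient _
    simp only [OLag.ambient_map, OLag.ambient_prod, map_mul, exteriorAlgebra_map_map, mul_assoc]
    rfl

/-- The zero space, as an oriented Lagrangian of the zero symplectic space with orientation `1`. -/
def zeroOLag (F : Type) [Field F] : OLag (zero F) where
  space := ⊤
  isLagrangian := by
    refine Submodule.ext fun x => ?_
    rw [LinearMap.BilinForm.mem_orthogonal_iff]
    exact ⟨fun _ => trivial, fun _ _ _ => rfl⟩
  orient := 1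
  orient_mem := by
    have : Module.finrank F (⊤ : Submodule F (zero F).carrier) = 0 := by
      rw [finrank_top]
      exact Module.finrank_zero_of_subsingleton (M := PUnit)
    rw [this]
    exact Submodule.one_le.1 le_rfl
  orient_ne_zero := one_ne_zero

theorem zeroOLag_ambient : (zeroOLag F).ambient = 1 := map_one _

theorem OLag.map_zeroProdHom_symm {V : Symp F} (L : OLag V) :
    L.map (zeroProdHom V).symm = (zeroOLag F).prod L := by
  refine OLag.ext_of_map ?_ ?_
  · refine Submodule.ext fun x => ?_
    constructor
    · rintro ⟨y, hy, rfl⟩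
      exact ⟨trivial, hy⟩
    · rintro ⟨-, h⟩
      exact ⟨x.2, h, rfl⟩
  · change OLag.ambient _ = OLag.ambient _
    rw [OLag.ambient_map, OLag.ambient_prod, zeroOLag_ambient, map_one, one_mul]
    rfl

theorem OLag.map_prodZeroHom_symm {V : Symp F} (L : OLag V) :
    L.map (prodZeroHom V).symm = L.prod (zeroOLag F) := by
  refine OLag.ext_of_map ?_ ?_
  · refine Submodule.ext fun x => ?_
    constructor
    · rintro ⟨y, hy, rfl⟩
      exact ⟨hy, trivial⟩
    · rintro ⟨h, -⟩
      exact ⟨x.1, h, rfl⟩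
  · change OLag.ambient _ = OLag.ambient _
    rw [OLag.ambient_map, OLag.ambient_prod, zeroOLag_ambient, map_one, mul_one]
    rfl

end Ambient

/-! ### Unit, naturality and coherence of the tensor isomorphism -/

section Coherence

theorem toSpanSingleton_deltaFun_bijective (ψ : AddChar F ℂ) : Function.Bijective
    (LinearMap.toSpanSingleton ℂ (model ψ (zero F) (zeroOLag F).space)
      (deltaFun ψ (zeroOLag F).isLagrangian 0)) := by
  -- The zero space has a single point, so the delta function equals 1 at every (v, 0).
  have h : ∀ (c : ℂ) (v : (zero F).carrier),
      (c • deltaFun ψ (zeroOLag F).isLagrangian 0).1 (Heis.ofVec v) = c := fun c v =>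
    (congrArg (c * ·) (deltaFun_apply_self (zeroOLag F).isLagrangian v)).trans (mul_one c)
  refine ⟨fun c d hcd => ?_, fun f => ⟨f.1 (Heis.ofVec 0), model_ext fun v => h _ v⟩⟩
  rw [← h c 0, ← h d 0]
  exact congrFun (congrArg Subtype.val hcd) _

variable [Fintype F] [DecidableEq F] {ψ : AddChar F ℂ}

open TensorProduct

/-- The isomorphism `ℂ ≃ ℋ(0)`. -/
def unitEquiv (hF : ringChar F ≠ 2) (hψ : ψ ≠ 1) : ℂ ≃ₗ[ℂ] CanonicalSpace ψ (zero F) :=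
  (LinearEquiv.ofBijective _ (toSpanSingleton_deltaFun_bijective ψ)).trans
    (evalEquiv hF hψ (zeroOLag F)).symm

theorem unitEquiv_apply_apply (hF : ringChar F ≠ 2) (hψ : ψ ≠ 1) (c : ℂ) (v : (zero F).carrier) :
    ((unitEquiv hF hψ c).1 (zeroOLag F)).1 (Heis.ofVec v) = c := by
  change (evalEquiv hF hψ (zeroOLag F) ((evalEquiv hF hψ (zeroOLag F)).symm
    (c • deltaFun ψ (zeroOLag F).isLagrangian 0))).1 (Heis.ofVec v) = c
  rw [LinearEquiv.apply_symm_apply]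
  exact (congrArg (c * ·) (deltaFun_apply_self (zeroOLag F).isLagrangian v)).trans (mul_one _)

/-- Pull-back along f × g sends L × M to f(L) × g(M) with the product orientation, and at such a
Lagrangian both sides are given by the ⊠ formula. -/
theorem canonicalMap_tensorEquiv (hF : ringChar F ≠ 2) (hψ : ψ ≠ 1) {V V' W W' : Symp F}
    (f : Hom V V') (g : Hom W W') :
    canonicalMap ψ (Hom.prodMap f g) ∘ₗ (tensorEquiv hF hψ V' W').toLinearMap =
      (tensorEquiv hF hψ V W).toLinearMap ∘ₗ
        TensorProduct.map (canonicalMap ψ f) (canonicalMap ψ g) := by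
  refine TensorProduct.ext' fun v w => ?_
  refine CanonicalSpace.ext_of_apply_eq hF hψ ((Classical.arbitrary (OLag V)).prod
    (Classical.arbitrary (OLag W))) fun x => ?_
  refine (CanonicalSpace.apply_congr (tensorEquiv hF hψ V' W' (v ⊗ₜ w)) (OLag.prod_map f g _ _)
    (Heis.map (Hom.prodMap f g) x)).trans ?_
  exact (tensorEquiv_tmul_apply_apply hF hψ v w _ _ _).trans
    (tensorEquiv_tmul_apply_apply hF hψ (canonicalMap ψ f v) (canonicalMap ψ g w) _ _ x).symm

theorem tensorEquiv_assoc (hF : ringChar F ≠ 2) (hψ : ψ ≠ 1) (U V W : Symp F) :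
    canonicalMap ψ (assocHom U V W).symm ∘ₗ (tensorEquiv hF hψ (U.prod V) W).toLinearMap ∘ₗ
        (tensorEquiv hF hψ U V).toLinearMap.rTensor (CanonicalSpace ψ W) =
      (tensorEquiv hF hψ U (V.prod W)).toLinearMap ∘ₗ
        (tensorEquiv hF hψ V W).toLinearMap.lTensor (CanonicalSpace ψ U) ∘ₗ
          (TensorProduct.assoc ℂ (CanonicalSpace ψ U) (CanonicalSpace ψ V)
            (CanonicalSpace ψ W)).toLinearMap := by
  refine TensorProduct.ext_threefold fun u v w => ?_
  obtain ⟨L⟩ : Nonempty (OLag U) := inferInstance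
  obtain ⟨M⟩ : Nonempty (OLag V) := inferInstance
  obtain ⟨N⟩ : Nonempty (OLag W) := inferInstance
  refine CanonicalSpace.ext_of_apply_eq hF hψ (L.prod (M.prod N)) fun x => ?_
  refine (CanonicalSpace.apply_congr (tensorEquiv hF hψ (U.prod V) W
    (tensorEquiv hF hψ U V (u ⊗ₜ v) ⊗ₜ w)) (OLag.prod_map_assoc_symm L M N)
      (Heis.map (assocHom U V W).symm x)).trans ?_
  refine (tensorEquiv_tmul_apply_apply hF hψ (tensorEquiv hF hψ U V (u ⊗ₜ v)) w (L.prod M) N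
    _).trans (Eq.trans ?_ (tensorEquiv_tmul_apply_apply hF hψ u
      (tensorEquiv hF hψ V W (v ⊗ₜ w)) L (M.prod N) x).symm)
  rw [tensorEquiv_tmul_apply_apply, tensorEquiv_tmul_apply_apply]
  -- The inner exterior products are evaluated at central coordinate 0, so their ψ-factors are 1.
  change ψ x.z * ((ψ 0 * _) * _) = ψ x.z * (_ * (ψ 0 * _))
  rw [AddChar.map_zero_eq_one, one_mul, one_mul, mul_assoc]
  rfl

theorem tensorEquiv_unit_left (hF : ringChar F ≠ 2) (hψ : ψ ≠ 1) (V : Symp F) :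
    canonicalMap ψ (zeroProdHom V).symm ∘ₗ (tensorEquiv hF hψ (zero F) V).toLinearMap ∘ₗ
        (unitEquiv hF hψ).toLinearMap.rTensor (CanonicalSpace ψ V) =
      (TensorProduct.lid ℂ (CanonicalSpace ψ V)).toLinearMap := by
  refine TensorProduct.ext' fun c v => ?_
  obtain ⟨L⟩ : Nonempty (OLag V) := inferInstance
  refine CanonicalSpace.ext_of_apply_eq hF hψ L fun x => ?_
  refine (CanonicalSpace.apply_congr (tensorEquiv hF hψ (zero F) V (unitEquiv hF hψ c ⊗ₜ v))
    (OLag.map_zeroProdHom_symm L) (Heis.map (zeroProdHom V).symm x)).trans ?_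
  refine (tensorEquiv_tmul_apply_apply hF hψ (unitEquiv hF hψ c) v (zeroOLag F) L _).trans ?_
  rw [unitEquiv_apply_apply, mul_left_comm]
  exact congrArg (c * ·) (model_apply_eq (v.1 L) x).symm

theorem tensorEquiv_unit_right (hF : ringChar F ≠ 2) (hψ : ψ ≠ 1) (V : Symp F) :
    canonicalMap ψ (prodZeroHom V).symm ∘ₗ (tensorEquiv hF hψ V (zero F)).toLinearMap ∘ₗ
        (unitEquiv hF hψ).toLinearMap.lTensor (CanonicalSpace ψ V) =
      (TensorProduct.rid ℂ (CanonicalSpace ψ V)).toLinearMap := by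
  refine TensorProduct.ext' fun v c => ?_
  obtain ⟨L⟩ : Nonempty (OLag V) := inferInstance
  refine CanonicalSpace.ext_of_apply_eq hF hψ L fun x => ?_
  refine (CanonicalSpace.apply_congr (tensorEquiv hF hψ V (zero F) (v ⊗ₜ unitEquiv hF hψ c))
    (OLag.map_prodZeroHom_symm L) (Heis.map (prodZeroHom V).symm x)).trans ?_
  refine (tensorEquiv_tmul_apply_apply hF hψ v (unitEquiv hF hψ c) L (zeroOLag F) _).trans ?_
  rw [unitEquiv_apply_apply, mul_comm _ c, mul_left_comm]
  exact congrArg (c * ·) (model_apply_eq (v.1 L) x).symm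

open MonoidalCategory Opposite

/-- The monoidal structure of the quantization functor. -/
def quantizationCoreMonoidal (hF : ringChar F ≠ 2) (hψ : ψ ≠ 1) :
    (quantization (F := F) ψ).CoreMonoidal where
  εIso := (unitEquiv hF hψ).toFGModuleCatIso
  μIso V W := (tensorEquiv hF hψ V.unop W.unop).toFGModuleCatIso
  μIso_hom_natural_left {V W} f U := by
    apply FGModuleCat.hom_ext
    have h := canonicalMap_tensorEquiv hF hψ f.unop (Hom.id U.unop)
    rw [canonicalMap_id] at h
    exact h.symm
  μIso_hom_natural_right {V W} U f := by
    apply FGModuleCat.hom_ext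
    have h := canonicalMap_tensorEquiv hF hψ (Hom.id U.unop) f.unop
    rw [canonicalMap_id] at h
    exact h.symm
  -- The associator of the opposite category is the inverse one, which is why `tensorEquiv_assoc`
  -- pulls back along `(assocHom U V W).symm`; the unitors behave likewise.
  associativity U V W := by
    apply FGModuleCat.hom_ext
    exact tensorEquiv_assoc hF hψ U.unop V.unop W.unop
  left_unitality V := by
    apply FGModuleCat.hom_ext
    exact (tensorEquiv_unit_left hF hψ V.unop).symm
  right_unitality V := by
    apply FGModuleCat.hom_ext
    exact (tensorEquiv_unit_right hF hψ V.unop).symm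

/-- As ρ(g) = ℋ(g⁻¹), this is naturality at the pair g₁⁻¹, g₂⁻¹ and so holds for any monoidal
structure on ℋ. -/
theorem productIso_weilRep [(quantization (F := F) ψ).Monoidal] (V W : Symp F)
    (g : Sp V × Sp W) :
    (productIso ψ V W).toLinearMap ∘ₗ weilRep ψ (V ⊗ W) (spProd V W g) =
      TensorProduct.map (weilRep ψ V g.1) (weilRep ψ W g.2) ∘ₗ (productIso ψ V W).toLinearMap := by
  have h := Functor.OplaxMonoidal.δ_natural (quantization (F := F) ψ) (Sp.toHom g.1⁻¹).op
    (Sp.toHom g.2⁻¹).op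
  exact (congrArg (fun k => k.hom.hom) h).symm

end Coherence

end CanonicalQuantization

end

open CategoryTheory MonoidalCategory CanonicalQuantization in
theorem mainTheorem7 {F : Type} [Field F] [Fintype F] [DecidableEq F] (hF : ringChar F ≠ 2)
    (ψ : AddChar F ℂ) (hψ : ψ ≠ 1) :
    (∀ V : Symp F, ∃! T : IntertwiningSystem ψ V, IsCanonicalSystem ψ V T) ∧
    ∃ _ : (quantization (F := F) ψ).Monoidal,
      ∀ (V₁ V₂ : Symp F) (g : Symp.Sp V₁ × Symp.Sp V₂),
        (productIso ψ V₁ V₂).toLinearMap ∘ₗ weilRep ψ (V₁ ⊗ V₂) (Symp.spProd V₁ V₂ g) =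
          TensorProduct.map (weilRep ψ V₁ g.1) (weilRep ψ V₂ g.2) ∘ₗ
            (productIso ψ V₁ V₂).toLinearMap := by
  refine ⟨existsUnique_isCanonicalSystem hF hψ, (quantizationCoreMonoidal hF hψ).toMonoidal, ?_⟩
  intro V₁ V₂ g
  let _ := (quantizationCoreMonoidal hF hψ).toMonoidal
  exact productIso_weilRep V₁ V₂ g
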